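/- Let $d\ge 3$ and $R\ge 1$ be integers, let $\alpha\in[0,1]$, let $|\cdot|_1$ be the $\ell^1$-norm on $\mathbb Z^d$, and let $B_1(R)=\{x\in\mathbb Z^d:|x|_1\le R\}$. The voter model of range $R$ on $\mathbb Z^d$ is the Feller process $(\xi_t)_{t\ge 0}$ on $\{0,1\}^{\mathbb Z^d}$ whose generator is given, on functions $f$ that depend on finitely many coordinates, by $$(\mathcal L f)(\xi)=\sum_{x,y\in\mathbb Z^d:\ 0<|x-y|_1\le R}\frac{f(\xi^{y\to x})-f(\xi)}{|B_1(R)|-1},$$ where $\xi^{y\to x}(x)=\xi(y)$ and $\xi^{y\to x}(z)=\xi(z)$ for $z\ne x$. Let $\pi_\alpha$ be the product Bernoulli($\alpha$) measure on $\{0,1\}^{\mathbb Z^d}$ (each site has state $1$ with probability $\alpha$), and let $\mu_{\alpha,R}$ be the distributional limit, as $t\to\infty$, of the law of $\xi_t$ for the process started from $\pi_\alpha$. An $R$-spread-out random walk on $\mathbb Z^d$ is the continuous-time random walk with independent Exponential(1) holding times and independent jumps uniformly distributed on $B_1(R)\setminus\{0\}$. Let $h_R(u,v)$ be the probability that two independent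 $R$-spread-out random walks started at $u$ and $v$ are ever at the same site at the same time. For a finite set $B\subseteq\mathbb Z^d$ let $\mathcal F_B$ be the collection of events $\{\xi:\xi|_B\in E_0\}$ with $E_0\subseteq\{0,1\}^B$. For $x\in\mathbb Z^d$ and an event $E$ put $\theta_xE=\{\xi(\cdot-x):\xi\in E\}$. Let $\prec$ be a well-ordering of $\mathbb Z^d$. Let $B\subseteq\mathbb Z^d$ be finite with $0\in B$, and let $x_1,\dots,x_n\in\mathbb Z^d$ be such that the sets $x_i+B$, $1\le i\le n$, are pairwise disjoint. Then, for every $E\in\mathcal F_B$, $$\mu_{\alpha,R}\Big(\bigcap_{i=1}^n\theta_{x_i}E\Big)\le \pi_\alpha(E)^n\cdot\prod_{\substack{u,v\in\bigcup_i(x_i+B)\\ u\prec v}}\Big(1+h_R(u,v)\big(\pi_\alpha(E)^{-2}-1\big)\Big).$$ If $\pi_\alpha(E)=0$ and $n\ge 1$, the right-hand side is read as $0$. -/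

import Mathlib

open MeasureTheory ProbabilityTheory Filter Topology
open scoped NNReal unitInterval

noncomputable section

namespace VoterModel

/-- The lattice `ℤ^d`. -/
abbrev Site (d : ℕ) : Type := Fin d → ℤ

/-- Configurations in `{0,1}^(ℤ^d)`, with the product topology and the product `σ`-algebra;
`true` is the state `1` and `false` is the state `0`. -/
abbrev Config (d : ℕ) : Type := Site d → Bool

/-- The `ℓ¹`-norm on `ℤ^d`. -/
def l1 {d : ℕ} (x : Site d) : ℕ := ∑ i, (x i).natAbs

/-- The ball `B_1(R)` of radius `R` around the origin in the `ℓ¹`-norm. -/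
def ball1 (d R : ℕ) : Set (Site d) := {x | l1 x ≤ R}

/-- `𝓕_A`: the events that are determined by the states of the sites of `A`. -/
def cylinderSets {d : ℕ} (A : Finset (Site d)) : Set (Set (Config d)) :=
  {E | ∃ E₀ : Set (A → Bool), E = {ξ | (A.restrict ξ : A → Bool) ∈ E₀}}

/-- The translated configuration `τ_x ξ`. -/
def shift {d : ℕ} (x : Site d) (ξ : Config d) : Config d := fun y => ξ (y - x)

/-- The translated event `θ_x E`. -/
def shiftEvent {d : ℕ} (x : Site d) (E : Set (Config d)) : Set (Config d) := shift x '' E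

/-- `π_α`: the states of the sites are independent and Bernoulli(`α`) distributed. -/
def productBernoulli (d : ℕ) (α : I) : Measure (Config d) :=
  Measure.infinitePi fun _ : Site d => bernoulliMeasure true false α

/-! ### The voter model and its stationary measures -/

/-- `ξ^{y → x}`: the site `x` copies the state of the site `y`. -/
def copy {d : ℕ} (ξ : Config d) (y x : Site d) : Config d := Function.update ξ x (ξ y)

open Classical in
/-- The pregenerator of the voter model of range `R`; it is meant for functions `f` that depend on
finitely many coordinates, for which only finitely many terms of the sum are nonzero. -/
def pregenerator (d R : ℕ) (f : Config d → ℝ) (ξ : Config d) : ℝ :=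
  ∑' p : Site d × Site d,
    if 0 < l1 (p.1 - p.2) ∧ l1 (p.1 - p.2) ≤ R then
      (f (copy ξ p.2 p.1) - f ξ) / (((ball1 d R).ncard : ℝ) - 1)
    else 0

/-- A Markov semigroup on the space of continuous functions on a compact space `X`: the transition
semigroup `S t f (ξ) = E^ξ[f(ξ_t)]` of a Feller process. -/
structure IsMarkovSemigroup {X : Type*} [TopologicalSpace X] [CompactSpace X]
    (S : ℝ≥0 → C(X, ℝ) →ₗ[ℝ] C(X, ℝ)) : Prop where
  zero : S 0 = LinearMap.id
  rightContinuous : ∀ (f : C(X, ℝ)) (t : ℝ≥0),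
    ContinuousWithinAt (fun s => S s f) (Set.Ici t) t
  add : ∀ (s t : ℝ≥0) (f : C(X, ℝ)), S (s + t) f = S s (S t f)
  one : ∀ t : ℝ≥0, S t 1 = 1
  nonneg : ∀ (t : ℝ≥0) (f : C(X, ℝ)), 0 ≤ f → 0 ≤ S t f

/-- `S` is the transition semigroup of the voter model of range `R` on `ℤ^d`: a Markov semigroup
whose generator is given by `pregenerator d R` on the functions of finitely many coordinates. -/
structure IsVoterSemigroup (d R : ℕ) (S : ℝ≥0 → C(Config d, ℝ) →ₗ[ℝ] C(Config d, ℝ)) :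
    Prop where
  markov : IsMarkovSemigroup S
  generator : ∀ (A : Finset (Site d)) (f : C(Config d, ℝ)), DependsOn f (A : Set (Site d)) →
    TendstoUniformly (fun (t : ℝ≥0) ξ => (S t f ξ - f ξ) / (t : ℝ)) (pregenerator d R f)
      (𝓝[>] (0 : ℝ≥0))

/-- `μ` is the measure `μ_{α,R}`: the distributional limit, as time tends to infinity, of the voter
model of range `R` on `ℤ^d` started from `π_α`. Its law at time `t` integrates the continuous
function `f` to `∫ S t f ∂π_α`. -/
def IsVoterLimit (d R : ℕ) (α : I) (μ : Measure (Config d)) : Prop :=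
  IsProbabilityMeasure μ ∧
    ∃ S : ℝ≥0 → C(Config d, ℝ) →ₗ[ℝ] C(Config d, ℝ), IsVoterSemigroup d R S ∧
      ∀ f : C(Config d, ℝ),
        Tendsto (fun t : ℝ≥0 => ∫ ξ, S t f ξ ∂(productBernoulli d α)) atTop
          (𝓝 (∫ ξ, f ξ ∂μ))

/-! ### Spread-out random walks -/

/-- The law of the driving randomness of an `R`-spread-out walk: an i.i.d. sequence of pairs, each
consisting of an Exponential(1) holding time and an independent jump that is uniformly distributed
on `B_1(R) \ {0}`. -/
def walkMeasure (d R : ℕ) : Measure (ℕ → ℝ × Site d) :=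
  Measure.infinitePi fun _ : ℕ => (expMeasure 1).prod (uniformOn (ball1 d R \ {0}))

/-- The number of jumps up to and including time `t`, the `k`-th holding time being `(ω k).1`. -/
def jumpCount {d : ℕ} (ω : ℕ → ℝ × Site d) (t : ℝ) : ℕ :=
  sInf {m : ℕ | t < ∑ k ∈ Finset.range (m + 1), (ω k).1}

/-- The position at time `t` of the walk started at `z`, the `k`-th jump being `(ω k).2`. -/
def walk {d : ℕ} (z : Site d) (ω : ℕ → ℝ × Site d) (t : ℝ) : Site d :=
  z + ∑ k ∈ Finset.range (jumpCount ω t), (ω k).2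

/-- `h_R(u,v)`: the probability that two independent `R`-spread-out walks started at `u` and `v`
ever meet. -/
def meetProb {d : ℕ} (R : ℕ) (u v : Site d) : ℝ :=
  ((walkMeasure d R).prod (walkMeasure d R)).real
    {p | ∃ t : ℝ, 0 ≤ t ∧ walk u p.1 t = walk v p.2 t}

end VoterModel

end

/-! The proof rests on duality with coalescing walks. If a site `z` copies its neighbour, reading
the configuration at positions `X` afterwards amounts to reading the old one with every walker at
`z` moved to that neighbour. Hence the expectation at time `t` of a cylinder function read at `X`,
as a function of `X`, solves the backward equation of coalescing walks
(`hasDerivWithinAt_meanAt_relabel`). A maximum principle (`meanAt_relabel_le`) then bounds it by any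
suitable superharmonic function.

Put `p = π_α(E)` and `a = p⁻² - 1`. For the blocks `x i + B`, `i ∈ J`, the dominating function is `p
^ |J|` times the sum, over all matchings of the sites of these blocks, of the product of `a * η`
over the edges, where `η` is the meeting probability. As long as the positions are distinct, a jump
moves a single walker and thus touches at most one edge of a matching, so superharmonicity of `η`
for two independent walks makes the whole sum superharmonic (`coalGen_pairingWeight_nonpos`). Its
initial value dominates because at distinct positions the blocks are independent and the empty
matching already contributes `1`.

When two walkers `u`, `v` share a position, the at most two blocks that contain them are discarded,
and induction on `J` bounds the remaining ones. The lost factor `p⁻² = 1 + a` is exactly regained by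
allowing the edge `{u, v}`, whose weight is `a` because `η = 1` on the diagonal
(`one_add_mul_pairingSum_le`). This is what dictates the value of `a`.

Finally, expanding the product over all pairs shows that it dominates the matching sum, and the
bound, being uniform in time, passes to the limit law. Superharmonicity of the meeting probability
(`isMeetingKernel_meetKernel`) comes from conditioning on the first jump and the memoryless
property. -/

noncomputable section

namespace VoterModel

/-! ### Markov semigroups -/

section Semigroup

set_option linter.unusedSectionVars false

variable {X : Type*} [TopologicalSpace X] [CompactSpace X]
  {S : ℝ≥0 → C(X, ℝ) →ₗ[ℝ] C(X, ℝ)}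

lemma IsMarkovSemigroup.mono (hS : IsMarkovSemigroup S) (t : ℝ≥0) {f g : C(X, ℝ)} (h : f ≤ g) :
    S t f ≤ S t g := by
  have := hS.nonneg t (g - f) (sub_nonneg.2 h)
  rwa [map_sub, sub_nonneg] at this

lemma IsMarkovSemigroup.abs_apply_le (hS : IsMarkovSemigroup S) (t : ℝ≥0) {f : C(X, ℝ)} {c : ℝ}
    (h : ∀ x, |f x| ≤ c) (x : X) : |S t f x| ≤ c := by
  have h1 : f ≤ c • (1 : C(X, ℝ)) := fun y => by simpa using (abs_le.1 (h y)).2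
  have h2 : -(c • (1 : C(X, ℝ))) ≤ f := fun y => by simpa using (abs_le.1 (h y)).1
  have h1' := hS.mono t h1 x
  have h2' := hS.mono t h2 x
  rw [map_smul, hS.one] at h1'
  rw [map_neg, map_smul, hS.one] at h2'
  exact abs_le.2 ⟨by simpa using h2', by simpa using h1'⟩

variable [MeasurableSpace X] [BorelSpace X] (π : Measure X) [IsProbabilityMeasure π]

/-- The expectation at time `t` of the process with semigroup `S` and initial law `π`. -/
def meanAt (S : ℝ≥0 → C(X, ℝ) →ₗ[ℝ] C(X, ℝ)) (f : C(X, ℝ)) (t : ℝ) : ℝ :=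
  ∫ x, S t.toNNReal f x ∂π

lemma integrable_continuousMap (f : C(X, ℝ)) : Integrable f π :=
  f.continuous.integrable_of_hasCompactSupport (HasCompactSupport.of_compactSpace f)

lemma meanAt_sub (f g : C(X, ℝ)) (t : ℝ) :
    meanAt π S (f - g) t = meanAt π S f t - meanAt π S g t := by
  simp only [meanAt, map_sub, ContinuousMap.sub_apply]
  exact integral_sub (integrable_continuousMap π _) (integrable_continuousMap π _)

lemma meanAt_smul (c : ℝ) (f : C(X, ℝ)) (t : ℝ) :
    meanAt π S (c • f) t = c * meanAt π S f t := by
  simp only [meanAt, map_smul, ContinuousMap.smul_apply, smul_eq_mul]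
  exact integral_const_mul _ _

lemma meanAt_sum {ι : Type*} (s : Finset ι) (f : ι → C(X, ℝ)) (t : ℝ) :
    meanAt π S (∑ i ∈ s, f i) t = ∑ i ∈ s, meanAt π S (f i) t := by
  simp only [meanAt, map_sum, ContinuousMap.sum_apply]
  exact integral_finsetSum _ fun i _ => integrable_continuousMap π _

lemma meanAt_mono (hS : IsMarkovSemigroup S) {f g : C(X, ℝ)} (h : f ≤ g) (t : ℝ) :
    meanAt π S f t ≤ meanAt π S g t :=
  integral_mono (integrable_continuousMap π _) (integrable_continuousMap π _) (hS.mono _ h)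

lemma abs_meanAt_le (hS : IsMarkovSemigroup S) {f : C(X, ℝ)} {c : ℝ} (h : ∀ x, |f x| ≤ c)
    (t : ℝ) : |meanAt π S f t| ≤ c := by
  have := norm_integral_le_of_norm_le_const (μ := π) (f := S t.toNNReal f) (C := c)
    (Eventually.of_forall fun x => by simpa using hS.abs_apply_le t.toNNReal h x)
  simpa [meanAt] using this

lemma meanAt_zero (hS : IsMarkovSemigroup S) (f : C(X, ℝ)) : meanAt π S f 0 = ∫ x, f x ∂π := by
  simp [meanAt, hS.zero]

lemma meanAt_add (hS : IsMarkovSemigroup S) (f : C(X, ℝ)) {s t : ℝ} (hs : 0 ≤ s) (ht : 0 ≤ t) :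
    meanAt π S f (t + s) = meanAt π S (S s.toNNReal f) t := by
  simp only [meanAt, Real.toNNReal_add ht hs, hS.add]

/-- By the semigroup property the difference quotient at `t` is the mean at time `t` of the
difference quotient at `0`. Uniform convergence of the latter survives because the mean is a
contraction for the sup norm. -/
lemma hasDerivWithinAt_meanAt (hS : IsMarkovSemigroup S) {f g : C(X, ℝ)}
    (hfg : TendstoUniformly (fun (t : ℝ≥0) x => (S t f x - f x) / (t : ℝ)) g (𝓝[>] (0 : ℝ≥0)))
    {t : ℝ} (ht : 0 ≤ t) :
    HasDerivWithinAt (meanAt π S f) (meanAt π S g t) (Set.Ici t) t := by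
  rw [← hasDerivWithinAt_Ioi_iff_Ici, hasDerivWithinAt_iff_tendsto_slope' (by simp),
    Metric.tendsto_nhds]
  intro ε hε
  have hlim : Tendsto (fun s : ℝ => (s - t).toNNReal) (𝓝[>] t) (𝓝[>] (0 : ℝ≥0)) := by
    refine tendsto_nhdsWithin_iff.2 ⟨?_, ?_⟩
    · have : Continuous fun s : ℝ => (s - t).toNNReal := by fun_prop
      simpa using (this.tendsto t).mono_left nhdsWithin_le_nhds
    · filter_upwards [self_mem_nhdsWithin] with s hs
      simpa using hs
  have hunif := Metric.tendstoUniformly_iff.1 hfg (ε / 2) (by positivity)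
  filter_upwards [hlim.eventually hunif, self_mem_nhdsWithin] with s hs hst
  have hr : 0 < s - t := sub_pos.2 hst
  have hcoe : (((s - t).toNNReal : ℝ≥0) : ℝ) = s - t := Real.coe_toNNReal _ hr.le
  have heq : slope (meanAt π S f) t s - meanAt π S g t
      = meanAt π S ((s - t)⁻¹ • (S (s - t).toNNReal f - f) - g) t := by
    have : s = t + (s - t) := by ring
    rw [meanAt_sub, meanAt_smul, meanAt_sub, ← meanAt_add π hS f hr.le ht, ← this, slope_def_field]
    ring
  rw [Real.dist_eq, heq]
  refine (abs_meanAt_le π hS (c := ε / 2) (fun x => ?_) t).trans_lt (by linarith)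
  have := (hs x).le
  rw [hcoe, Real.dist_eq, abs_sub_comm] at this
  simpa [div_eq_inv_mul] using this

/-- An increment from `a` to `b` is the mean at time `a` of `S (b - a) f - f`, so right continuity
at `0` gives a modulus that is uniform in `a`, and with it left continuity as well. -/
lemma continuousOn_meanAt (hS : IsMarkovSemigroup S) (f : C(X, ℝ)) :
    ContinuousOn (meanAt π S f) (Set.Ici 0) := by
  rw [Metric.continuousOn_iff]
  intro t ht ε hε
  have h0 := hS.rightContinuous f 0
  have h0' := Metric.continuousWithinAt_iff.1 h0 (ε / 2) (by positivity)
  obtain ⟨δ, hδ, hcl⟩ := h0'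
  have key : ∀ a b : ℝ, 0 ≤ a → a ≤ b → b - a < δ →
      |meanAt π S f b - meanAt π S f a| < ε := by
    intro a b ha hab hd
    have hr : 0 ≤ b - a := sub_nonneg.2 hab
    have hb : b = a + (b - a) := by ring
    have : meanAt π S f b - meanAt π S f a = meanAt π S (S (b - a).toNNReal f - f) a := by
      rw [meanAt_sub, ← meanAt_add π hS f hr ha, ← hb]
    rw [this]
    refine (abs_meanAt_le π hS (c := ε / 2) (fun x => ?_) a).trans_lt (by linarith)
    have hd' := hcl (x := (b - a).toNNReal) (by simp)
      (by rw [NNReal.dist_eq]; simpa [Real.coe_toNNReal _ hr, abs_of_nonneg hr] using hd)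
    have h3 := (ContinuousMap.dist_apply_le_dist (f := S (b - a).toNNReal f) (g := S 0 f) x).trans
      hd'.le
    rw [Real.dist_eq, hS.zero] at h3
    simpa using h3
  refine ⟨δ, hδ, fun s hs hst => ?_⟩
  rw [Real.dist_eq] at hst ⊢
  rcases le_total t s with h | h
  · exact key t s ht h ((le_abs_self _).trans_lt hst)
  · rw [abs_sub_comm] at hst ⊢
    exact key s t hs h ((le_abs_self _).trans_lt hst)

end Semigroup

/-! ### The dual system of coalescing walks -/

variable {d : ℕ}

lemma ball1_finite (d R : ℕ) : (ball1 d R).Finite := by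
  refine (Set.finite_Icc (fun _ => -(R : ℤ)) (fun _ => (R : ℤ))).subset fun x hx => ?_
  have h : ∀ i, (x i).natAbs ≤ R := fun i =>
    (Finset.single_le_sum (f := fun i => (x i).natAbs) (fun _ _ => Nat.zero_le _)
      (Finset.mem_univ i)).trans hx
  exact ⟨fun i => by have := h i; simp; omega, fun i => by have := h i; simp; omega⟩

/-- The possible jumps of an `R`-spread-out walk. -/
def steps (d R : ℕ) : Finset (Site d) := (ball1_finite d R).toFinset.erase 0

lemma l1_eq_zero {x : Site d} : l1 x = 0 ↔ x = 0 := by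
  simp [l1, funext_iff]

lemma l1_neg (x : Site d) : l1 (-x) = l1 x := by simp [l1]

lemma mem_steps {R : ℕ} {w : Site d} : w ∈ steps d R ↔ 0 < l1 w ∧ l1 w ≤ R := by
  simp [steps, ball1, Nat.pos_iff_ne_zero, l1_eq_zero]

lemma coe_steps (d R : ℕ) : (steps d R : Set (Site d)) = ball1 d R \ {0} := by
  ext; simp [steps]

lemma card_steps (d R : ℕ) : ((steps d R).card : ℝ) = ((ball1 d R).ncard : ℝ) - 1 := by
  have h0 : (0 : Site d) ∈ (ball1_finite d R).toFinset := by simp [ball1, l1]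
  rw [steps, Finset.card_erase_of_mem h0, Nat.cast_sub (Finset.card_pos.2 ⟨0, h0⟩),
    Set.ncard_eq_toFinset_card _ (ball1_finite d R), Nat.cast_one]

lemma steps_nonempty {R : ℕ} (hd : 0 < d) (hR : 1 ≤ R) : (steps d R).Nonempty := by
  refine ⟨Pi.single ⟨0, hd⟩ 1, mem_steps.2 ?_⟩
  have : l1 (Pi.single (⟨0, hd⟩ : Fin d) (1 : ℤ)) = 1 := by
    rw [l1, Finset.sum_eq_single ⟨0, hd⟩] <;> simp +contextual
  omega

/-- Reading a configuration at the positions `X`. -/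
def relabel (X : Site d → Site d) : C(Config d, Config d) :=
  ⟨fun ξ => ξ ∘ X, by fun_prop⟩

/-- All walkers at `z` move to `y`; the position of the walker `i` is `X i`. -/
def move (X : Site d → Site d) (z y : Site d) : Site d → Site d :=
  fun i => if X i = z then y else X i

/-- One step of the duality between the voter model and coalescing walks. -/
lemma copy_comp (ξ : Config d) (X : Site d → Site d) (y z : Site d) :
    copy ξ y z ∘ X = ξ ∘ move X z y := by
  funext i
  by_cases h : X i = z <;> simp [copy, move, h]

/-- The generator of the coalescing walks with labels in `A`. -/
def coalGen (A : Finset (Site d)) (R : ℕ) (Φ : (Site d → Site d) → ℝ) (X : Site d → Site d) : ℝ :=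
  ∑ z ∈ A.image X, ∑ w ∈ steps d R, (Φ (move X z (z + w)) - Φ X) / (steps d R).card

/-- Only updates at occupied sites `z ∈ A.image X` can change the function, which leaves a finite
sum. Walkers that share a site form one index `z` and jump together: this is the coalescence. -/
lemma pregenerator_relabel {A : Finset (Site d)} {f : C(Config d, ℝ)}
    (hf : DependsOn f (A : Set (Site d))) (R : ℕ) (X : Site d → Site d) (ξ : Config d) :
    pregenerator d R (f.comp (relabel X)) ξ
      = coalGen A R (fun Y => f.comp (relabel Y) ξ) X := by
  classical
  have hinj : Set.InjOn (fun p : Site d × Site d => (p.1, p.1 + p.2))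
      ((A.image X ×ˢ steps d R : Finset (Site d × Site d)) : Set (Site d × Site d)) := by
    rintro ⟨a, b⟩ - ⟨a', b'⟩ - h
    simp only [Prod.mk.injEq] at h
    obtain ⟨rfl, h⟩ := h
    simpa using h
  rw [pregenerator, tsum_eq_sum (s := (A.image X ×ˢ steps d R).image fun p => (p.1, p.1 + p.2)),
    Finset.sum_image hinj, Finset.sum_product, coalGen]
  · refine Finset.sum_congr rfl fun z _ => Finset.sum_congr rfl fun w hw => ?_
    have hw' : 0 < l1 (z - (z + w)) ∧ l1 (z - (z + w)) ≤ R := by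
      rw [sub_add_cancel_left, l1_neg]; exact mem_steps.1 hw
    rw [if_pos hw', card_steps]
    simp [relabel, copy_comp]
  · rintro ⟨z, y⟩ hp
    split_ifs with hzy
    · have hz : z ∉ A.image X := by
        intro hz
        refine hp (Finset.mem_image.2 ⟨(z, y - z), Finset.mem_product.2 ⟨hz, mem_steps.2 ?_⟩, ?_⟩)
        · rw [← l1_neg, neg_sub]; exact hzy
        · simp
      have : f (copy ξ y z ∘ X) = f (ξ ∘ X) := by
        refine hf fun i hi => ?_
        have hne : X i ≠ z := fun h => hz (h ▸ Finset.mem_image_of_mem X hi)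
        simp [copy, hne]
      simp [relabel, this]
    · rfl

lemma DependsOn.relabel {A : Finset (Site d)} {f : C(Config d, ℝ)}
    (hf : DependsOn f (A : Set (Site d))) (X : Site d → Site d) :
    DependsOn (f.comp (relabel X)) ((A.image X : Finset (Site d)) : Set (Site d)) := by
  intro ξ η h
  exact hf fun i hi => h _ (Finset.mem_coe.2 (Finset.mem_image_of_mem X hi))

variable {R : ℕ} {S : ℝ≥0 → C(Config d, ℝ) →ₗ[ℝ] C(Config d, ℝ)} (π : Measure (Config d))
  [IsProbabilityMeasure π]

/-- The mean of a function of finitely many coordinates, read at the positions `X`, solves the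
evolution equation of the coalescing walks. -/
lemma hasDerivWithinAt_meanAt_relabel (hS : IsVoterSemigroup d R S) {A : Finset (Site d)}
    {f : C(Config d, ℝ)} (hf : DependsOn f (A : Set (Site d))) (X : Site d → Site d) {t : ℝ}
    (ht : 0 ≤ t) :
    HasDerivWithinAt (meanAt π S (f.comp (relabel X)))
      (coalGen A R (fun Y => meanAt π S (f.comp (relabel Y)) t) X) (Set.Ici t) t := by
  set g : C(Config d, ℝ) := ∑ z ∈ A.image X, ∑ w ∈ steps d R, ((steps d R).card : ℝ)⁻¹ •
    (f.comp (relabel (move X z (z + w))) - f.comp (relabel X)) with hg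
  have hgen : pregenerator d R (f.comp (relabel X)) = g := by
    funext ξ
    rw [pregenerator_relabel hf, hg, coalGen]
    simp only [ContinuousMap.sum_apply, ContinuousMap.smul_apply, ContinuousMap.sub_apply,
      smul_eq_mul, div_eq_inv_mul]
  have h := hS.generator _ _ (DependsOn.relabel hf X)
  rw [hgen] at h
  have h' := hasDerivWithinAt_meanAt π hS.markov h ht
  convert h' using 1
  simp only [hg, meanAt_sum, meanAt_smul, meanAt_sub, coalGen, div_eq_inv_mul]

/-! ### The maximum principle -/

/-- Each occupied site jumps at rate one, so adding the total rate times `D X` leaves a sum of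
averages of `D` over the positions after a jump. -/
lemma coalGen_add_card_mul_le {A : Finset (Site d)} {D : (Site d → Site d) → ℝ} {K : ℝ}
    (hs : (steps d R).Nonempty) (hD : ∀ Y, D Y ≤ K) (X : Site d → Site d) :
    coalGen A R D X + (A.image X).card * D X ≤ (A.image X).card * K := by
  have hN : (0 : ℝ) < (steps d R).card := by exact_mod_cast hs.card_pos
  have h1 : coalGen A R D X ≤ ∑ z ∈ A.image X, (K - D X) := by
    refine Finset.sum_le_sum fun z _ => ?_
    have : ∑ w ∈ steps d R, (D (move X z (z + w)) - D X) / (steps d R).card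
        ≤ ∑ w ∈ steps d R, (K - D X) / (steps d R).card :=
      Finset.sum_le_sum fun w _ => by have := hD (move X z (z + w)); gcongr
    refine this.trans_eq ?_
    rw [Finset.sum_const, nsmul_eq_mul]
    field_simp
  rw [Finset.sum_const, nsmul_eq_mul] at h1
  linarith

lemma coalGen_sub (A : Finset (Site d)) (Φ Ψ : (Site d → Site d) → ℝ) (X : Site d → Site d) :
    coalGen A R (fun Y => Φ Y - Ψ Y) X = coalGen A R Φ X - coalGen A R Ψ X := by
  simp only [coalGen, ← Finset.sum_sub_distrib]
  refine Finset.sum_congr rfl fun z _ => Finset.sum_congr rfl fun w _ => ?_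
  ring

/-- A bounded function `W` that is superharmonic for the coalescing walks, except possibly where it
is known to dominate, dominates the mean at all times if it dominates at time `0`. -/
lemma meanAt_relabel_le (hS : IsVoterSemigroup d R S) (hs : (steps d R).Nonempty)
    {A : Finset (Site d)} {f : C(Config d, ℝ)} (hf : DependsOn f (A : Set (Site d)))
    {W : (Site d → Site d) → ℝ} {c : ℝ} (hWc : ∀ X, c ≤ W X)
    (hW : ∀ X, (∀ t, 0 ≤ t → meanAt π S (f.comp (relabel X)) t ≤ W X) ∨
      (coalGen A R W X ≤ 0 ∧ ∫ ξ, f (ξ ∘ X) ∂π ≤ W X))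
    (X : Site d → Site d) {T : ℝ} (hT : 0 ≤ T) : meanAt π S (f.comp (relabel X)) T ≤ W X := by
  let g : (Site d → Site d) → ℝ → ℝ := fun X t => meanAt π S (f.comp (relabel X)) t
  let C : ℝ := (A.card : ℝ)
  have hC : 0 ≤ C := Nat.cast_nonneg _
  have hexp : Real.exp (-(C * T)) ≤ 1 := Real.exp_le_one_iff.2 (by nlinarith)
  have hexp0 : 0 < Real.exp (-(C * T)) := Real.exp_pos _
  -- The set of positions is infinite, so a supremum need not be attained and the usual maximum
  -- argument is unavailable. Instead any bound `K` improves by a fixed factor below one: the total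
  -- jump rate is at most `C`, so up to time `T` no jump occurs with probability at least `exp (-(C
  -- * T))`. Iteration drives the bound to `0`.
  have step : ∀ K : ℝ, 0 ≤ K → (∀ X, ∀ t ∈ Set.Icc 0 T, g X t - W X ≤ K) →
      ∀ X, ∀ t ∈ Set.Icc 0 T, g X t - W X ≤ (1 - Real.exp (-(C * T))) * K := by
    intro K hK hb X t ht
    rcases hW X with h | ⟨hsup, hinit⟩
    · have : g X t - W X ≤ 0 := sub_nonpos.2 (h t ht.1)
      exact this.trans (mul_nonneg (by linarith) hK)
    let m : ℝ := ((A.image X).card : ℝ)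
    have hm : 0 ≤ m := Nat.cast_nonneg _
    have hmC : m ≤ C := Nat.cast_le.2 Finset.card_image_le
    have hexp' : ∀ s : ℝ, HasDerivAt (fun s => Real.exp (m * s)) (Real.exp (m * s) * m) s :=
      fun s => by simpa using ((hasDerivAt_id s).const_mul m).exp
    have hcont : ContinuousOn (fun s => Real.exp (m * s) * (g X s - W X)) (Set.Icc 0 T) :=
      (by fun_prop : Continuous fun s : ℝ => Real.exp (m * s)).continuousOn.mul
        (((continuousOn_meanAt π hS.markov (f.comp (relabel X))).mono
          Set.Icc_subset_Ici_self).sub continuousOn_const)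
    have hderiv : ∀ s ∈ Set.Ico 0 T,
        HasDerivWithinAt (fun s => Real.exp (m * s) * (g X s - W X))
          (Real.exp (m * s) * m * (g X s - W X)
            + Real.exp (m * s) * coalGen A R (fun Y => g Y s) X) (Set.Ici s) s := fun s hs =>
      (hexp' s).hasDerivWithinAt.mul
        ((hasDerivWithinAt_meanAt_relabel π hS hf X hs.1).sub_const (W X))
    -- The integrating factor `exp (m * s)` absorbs the jump rate `m`; what is left of the
    -- derivative is an average over jump targets, at most `m * K` since `coalGen A R W X ≤ 0`.
    have hbound := image_le_of_deriv_right_le_deriv_boundary hcont hderiv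
      (B := fun s => K * (Real.exp (m * s) - 1)) (B' := fun s => K * (Real.exp (m * s) * m))
      (by simpa [g, meanAt_zero π hS.markov, relabel] using hinit) (by fun_prop)
      (fun s _ => (((hexp' s).sub_const 1).const_mul K).hasDerivWithinAt)
      (fun s hs' => by
        have h1 := coalGen_add_card_mul_le (A := A) (R := R) (D := fun Y => g Y s - W Y) hs
          (fun Y => hb Y s ⟨hs'.1, hs'.2.le⟩) X
        rw [coalGen_sub] at h1
        have h2 : coalGen A R (fun Y => g Y s) X + m * (g X s - W X) ≤ m * K := by
          have : coalGen A R (fun Y => W Y) X ≤ 0 := hsup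
          simp only [m]
          linarith
        have h3 := mul_le_mul_of_nonneg_left h2 (Real.exp_pos (m * s)).le
        linarith) ht
    have h4 : Real.exp (-(m * t)) * (Real.exp (m * t) * (g X t - W X))
        ≤ Real.exp (-(m * t)) * (K * (Real.exp (m * t) - 1)) :=
      mul_le_mul_of_nonneg_left hbound (Real.exp_pos _).le
    have h5 : Real.exp (-(m * t)) * Real.exp (m * t) = 1 := by rw [← Real.exp_add]; simp
    have h6 : Real.exp (-(C * T)) ≤ Real.exp (-(m * t)) :=
      Real.exp_le_exp.2 (neg_le_neg (mul_le_mul hmC ht.2 ht.1 hC))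
    calc g X t - W X = Real.exp (-(m * t)) * (Real.exp (m * t) * (g X t - W X)) := by
          rw [← mul_assoc, h5, one_mul]
      _ ≤ _ := h4
      _ = (1 - Real.exp (-(m * t))) * K := by linear_combination K * h5
      _ ≤ _ := by gcongr
  obtain ⟨K, hK, hK'⟩ : ∃ K : ℝ, 0 ≤ K ∧ ∀ X, ∀ t ∈ Set.Icc 0 T, g X t - W X ≤ K := by
    refine ⟨|‖f‖ - c|, abs_nonneg _, fun X t _ => ?_⟩
    have h1 : g X t ≤ ‖f‖ := (le_abs_self _).trans
      (abs_meanAt_le π hS.markov (f := f.comp (relabel X)) (fun ξ => f.norm_coe_le_norm _) t)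
    exact (by linarith [hWc X] : g X t - W X ≤ ‖f‖ - c).trans (le_abs_self _)
  have iter : ∀ k : ℕ, ∀ X, ∀ t ∈ Set.Icc 0 T,
      g X t - W X ≤ (1 - Real.exp (-(C * T))) ^ k * K := by
    intro k
    induction k with
    | zero => simpa using hK'
    | succ k ih =>
      intro X t ht
      have := step _ (mul_nonneg (pow_nonneg (by linarith) k) hK) ih X t ht
      rwa [← mul_assoc, ← pow_succ'] at this
  have hlim : Tendsto (fun k : ℕ => (1 - Real.exp (-(C * T))) ^ k * K) atTop (𝓝 (0 * K)) :=
    (tendsto_pow_atTop_nhds_zero_of_lt_one (by linarith) (by linarith)).mul_const K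
  have := ge_of_tendsto' hlim fun k => iter k X T ⟨hT, le_rfl⟩
  linarith

end VoterModel

end

noncomputable section

namespace VoterModel

/-! ### Sums over matchings -/

/-- At most one factor changes, so no cross terms arise. -/
lemma prod_sub_prod_eq_sum {ι : Type*} [DecidableEq ι] (m : Finset ι) (b c : ι → ℝ)
    (h : ∀ e ∈ m, ∀ e' ∈ m, e ≠ e' → b e = c e ∨ b e' = c e') :
    ∏ e ∈ m, b e - ∏ e ∈ m, c e = ∑ e ∈ m, (∏ e' ∈ m.erase e, c e') * (b e - c e) := by
  by_cases hall : ∀ e ∈ m, b e = c e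
  · rw [Finset.prod_congr rfl hall, sub_self, Finset.sum_eq_zero]
    intro e he
    rw [hall e he, sub_self, mul_zero]
  push Not at hall
  obtain ⟨e₀, he₀, hne⟩ := hall
  have hother : ∀ e ∈ m, e ≠ e₀ → b e = c e := fun e he hee =>
    (h e he e₀ he₀ hee).resolve_right hne
  rw [Finset.sum_eq_single_of_mem e₀ he₀ fun e he hee => by rw [hother e he hee, sub_self, mul_zero],
    ← Finset.mul_prod_erase m b he₀, ← Finset.mul_prod_erase m c he₀,
    Finset.prod_congr rfl fun e he => hother e (Finset.mem_of_mem_erase he) (Finset.ne_of_mem_erase he)]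
  ring

variable {d R : ℕ} {prec : Site d → Site d → Prop}

/-- The edges of `m` are pairwise disjoint. -/
def IsPairing (m : Finset (Site d × Site d)) : Prop :=
  ∀ e ∈ m, ∀ e' ∈ m, e ≠ e' → Disjoint ({e.1, e.2} : Finset (Site d)) {e'.1, e'.2}

open Classical in
/-- The ordered pairs of sites of `A`. -/
def orderedPairs (prec : Site d → Site d → Prop) (A : Finset (Site d)) :
    Finset (Site d × Site d) :=
  (A ×ˢ A).filter fun p => prec p.1 p.2

open Classical in
/-- The matchings of the complete graph on `A`. -/
def pairings (prec : Site d → Site d → Prop) (A : Finset (Site d)) :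
    Finset (Finset (Site d × Site d)) :=
  (orderedPairs prec A).powerset.filter IsPairing

/-- The product over the edges of `m` of the weights `a * η`, read at the positions `X`. -/
def pairingWeight (a : ℝ) (η : Site d → Site d → ℝ) (m : Finset (Site d × Site d))
    (X : Site d → Site d) : ℝ :=
  ∏ e ∈ m, a * η (X e.1) (X e.2)

/-- The sum of the weights of all matchings of `A`. -/
def pairingSum (prec : Site d → Site d → Prop) (a : ℝ) (η : Site d → Site d → ℝ)
    (A : Finset (Site d)) (X : Site d → Site d) : ℝ :=
  ∑ m ∈ pairings prec A, pairingWeight a η m X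

lemma mem_orderedPairs {A : Finset (Site d)} {e : Site d × Site d} :
    e ∈ orderedPairs prec A ↔ (e.1 ∈ A ∧ e.2 ∈ A) ∧ prec e.1 e.2 := by
  simp [orderedPairs]

lemma mem_pairings {A : Finset (Site d)} {m : Finset (Site d × Site d)} :
    m ∈ pairings prec A ↔ m ⊆ orderedPairs prec A ∧ IsPairing m := by
  simp [pairings]

/-- A nonnegative kernel that is superharmonic for two independent walks off the diagonal. -/
structure IsMeetingKernel (R : ℕ) (η : Site d → Site d → ℝ) : Prop where
  nonneg : ∀ u v, 0 ≤ η u v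
  diag : ∀ u, η u u = 1
  superharmonic : ∀ u v, u ≠ v →
    ∑ w ∈ steps d R, (η (u + w) v - η u v) + ∑ w ∈ steps d R, (η u (v + w) - η u v) ≤ 0

variable {a : ℝ} {η : Site d → Site d → ℝ}

lemma pairingWeight_nonneg (ha : 0 ≤ a) (hη : IsMeetingKernel R η)
    (m : Finset (Site d × Site d)) (X : Site d → Site d) : 0 ≤ pairingWeight a η m X :=
  Finset.prod_nonneg fun _ _ => mul_nonneg ha (hη.nonneg _ _)

lemma one_le_pairingSum (ha : 0 ≤ a) (hη : IsMeetingKernel R η) (A : Finset (Site d))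
    (X : Site d → Site d) : 1 ≤ pairingSum prec a η A X := by
  have h : (∅ : Finset (Site d × Site d)) ∈ pairings prec A :=
    mem_pairings.2 ⟨Finset.empty_subset _, by simp [IsPairing]⟩
  have := Finset.single_le_sum (f := fun m => pairingWeight a η m X)
    (fun m _ => pairingWeight_nonneg ha hη m X) h
  simpa [pairingWeight, pairingSum] using this

lemma pairingSum_le_prod (ha : 0 ≤ a) (hη : IsMeetingKernel R η) (A : Finset (Site d))
    (X : Site d → Site d) :
    pairingSum prec a η A X ≤ ∏ e ∈ orderedPairs prec A, (1 + a * η (X e.1) (X e.2)) := by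
  classical
  rw [Finset.prod_one_add]
  exact Finset.sum_le_sum_of_subset_of_nonneg (Finset.filter_subset _ _)
    fun m _ _ => pairingWeight_nonneg ha hη m X

/-- A matching of `A'` yields two matchings of `A`: itself, and itself with the edge `{u, v}` added.
The second has `a` times the weight of the first, since the two walkers sit at the same site. -/
lemma one_add_mul_pairingSum_le [IsWellOrder (Site d) prec] (ha : 0 ≤ a)
    (hη : IsMeetingKernel R η) {A A' : Finset (Site d)} (hA : A' ⊆ A) {u v : Site d}
    (hu : u ∈ A) (hv : v ∈ A) (huv : u ≠ v) (hu' : u ∉ A') (hv' : v ∉ A')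
    {X : Site d → Site d} (hX : X u = X v) :
    (1 + a) * pairingSum prec a η A' X ≤ pairingSum prec a η A X := by
  classical
  wlog hprec : prec u v generalizing u v with hswap
  · have : prec v u := by
      rcases trichotomous_of prec u v with h | h | h
      · exact absurd h hprec
      · exact absurd h huv
      · exact h
    exact hswap hv hu huv.symm hv' hu' hX.symm this
  set e₀ : Site d × Site d := (u, v)
  have hmem : ∀ m ∈ pairings prec A', ∀ e ∈ m, e.1 ∈ A' ∧ e.2 ∈ A' := fun m hm e he =>
    (mem_orderedPairs.1 ((mem_pairings.1 hm).1 he)).1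
  have hnot : ∀ m ∈ pairings prec A', e₀ ∉ m := fun m hm he => hu' (hmem m hm e₀ he).1
  have hsub : pairings prec A' ∪ (pairings prec A').image (insert e₀) ⊆ pairings prec A := by
    have hle : orderedPairs prec A' ⊆ orderedPairs prec A := fun e he => by
      have := mem_orderedPairs.1 he
      exact mem_orderedPairs.2 ⟨⟨hA this.1.1, hA this.1.2⟩, this.2⟩
    refine Finset.union_subset (fun m hm => ?_) (fun m' hm' => ?_)
    · exact mem_pairings.2 ⟨(mem_pairings.1 hm).1.trans hle, (mem_pairings.1 hm).2⟩
    · obtain ⟨m, hm, rfl⟩ := Finset.mem_image.1 hm'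
      have hdis : ∀ e ∈ m, Disjoint ({e₀.1, e₀.2} : Finset (Site d)) {e.1, e.2} := by
        intro e he
        have h := hmem m hm e he
        have h1 : u ≠ e.1 := fun h' => hu' (h' ▸ h.1)
        have h2 : u ≠ e.2 := fun h' => hu' (h' ▸ h.2)
        have h3 : v ≠ e.1 := fun h' => hv' (h' ▸ h.1)
        have h4 : v ≠ e.2 := fun h' => hv' (h' ▸ h.2)
        simp [e₀, h1.symm, h2.symm, h3.symm, h4.symm]
      refine mem_pairings.2 ⟨Finset.insert_subset (mem_orderedPairs.2 ⟨⟨hu, hv⟩, hprec⟩)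
        ((mem_pairings.1 hm).1.trans hle), ?_⟩
      intro e he e' he' hne
      rcases Finset.mem_insert.1 he with rfl | he <;> rcases Finset.mem_insert.1 he' with rfl | he'
      · exact absurd rfl hne
      · exact hdis e' he'
      · exact (hdis e he).symm
      · exact (mem_pairings.1 hm).2 e he e' he' hne
  have hdisj : Disjoint (pairings prec A') ((pairings prec A').image (insert e₀)) := by
    rw [Finset.disjoint_left]
    intro m hm hm'
    obtain ⟨m', -, rfl⟩ := Finset.mem_image.1 hm'
    exact hnot _ hm (Finset.mem_insert_self _ _)
  have hinj : Set.InjOn (insert e₀) (pairings prec A' : Set (Finset (Site d × Site d))) := by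
    intro m hm m' hm' h
    rw [← Finset.erase_insert (hnot m hm), ← Finset.erase_insert (hnot m' hm'), h]
  calc (1 + a) * pairingSum prec a η A' X
      = ∑ m ∈ pairings prec A' ∪ (pairings prec A').image (insert e₀), pairingWeight a η m X := by
        rw [Finset.sum_union hdisj, Finset.sum_image hinj, add_mul, one_mul, pairingSum,
          Finset.mul_sum]
        congr 1
        refine Finset.sum_congr rfl fun m hm => ?_
        rw [pairingWeight, pairingWeight, Finset.prod_insert (hnot m hm)]
        simp [e₀, hX, hη.diag]
    _ ≤ _ := Finset.sum_le_sum_of_subset_of_nonneg hsub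
        fun m _ _ => pairingWeight_nonneg ha hη m X

/-- For injective `X` a jump moves one walker, and a matching has at most one edge at that walker.
So the generator acts edge by edge as that of two independent walks, with the other factors as
nonnegative constants. -/
lemma coalGen_pairingWeight_nonpos [IsWellOrder (Site d) prec] (ha : 0 ≤ a)
    (hη : IsMeetingKernel R η) {A : Finset (Site d)} {m : Finset (Site d × Site d)}
    (hm : m ∈ pairings prec A) {X : Site d → Site d} (hX : Set.InjOn X A) :
    coalGen A R (pairingWeight a η m) X ≤ 0 := by
  classical
  obtain ⟨hsub, hpair⟩ := mem_pairings.1 hm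
  have hmem : ∀ e ∈ m, (e.1 ∈ A ∧ e.2 ∈ A) ∧ e.1 ≠ e.2 := fun e he => by
    have := mem_orderedPairs.1 (hsub he)
    exact ⟨this.1, fun h => irrefl_of prec e.1 (by simpa [← h] using this.2)⟩
  have hmove : ∀ u ∈ A, ∀ i ∈ A, ∀ y, move X (X u) y i = if i = u then y else X i := by
    intro u hu i hi y
    simp [move, hX.eq_iff hi hu]
  set c : Site d × Site d → ℝ := fun e => a * η (X e.1) (X e.2) with hc
  set b : Site d → Site d → Site d × Site d → ℝ := fun u w e =>
    a * η (move X (X u) (X u + w) e.1) (move X (X u) (X u + w) e.2) with hb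
  have hbc : ∀ u ∈ A, ∀ w, ∀ e ∈ m, u ≠ e.1 → u ≠ e.2 → b u w e = c e := by
    intro u hu w e he h1 h2
    have := hmem e he
    simp only [hb, hc, hmove u hu _ this.1.1, hmove u hu _ this.1.2, if_neg h1.symm, if_neg h2.symm]
  have hprod : ∀ u ∈ A, ∀ w, pairingWeight a η m (move X (X u) (X u + w)) - pairingWeight a η m X
      = ∑ e ∈ m, (∏ e' ∈ m.erase e, c e') * (b u w e - c e) := by
    intro u hu w
    refine prod_sub_prod_eq_sum m (b u w) c fun e he e' he' hne => ?_
    by_contra hcon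
    push Not at hcon
    have h1 : u = e.1 ∨ u = e.2 := by
      by_contra h; push Not at h; exact hcon.1 (hbc u hu w e he h.1 h.2)
    have h2 : u = e'.1 ∨ u = e'.2 := by
      by_contra h; push Not at h; exact hcon.2 (hbc u hu w e' he' h.1 h.2)
    have hu1 : u ∈ ({e.1, e.2} : Finset (Site d)) := by simpa using h1
    have hu2 : u ∈ ({e'.1, e'.2} : Finset (Site d)) := by simpa using h2
    exact Finset.disjoint_left.1 (hpair e he e' he' hne) hu1 hu2
  have hedge : ∀ e ∈ m, ∑ u ∈ A, ∑ w ∈ steps d R, (b u w e - c e) ≤ 0 := by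
    intro e he
    obtain ⟨⟨h1, h2⟩, hne⟩ := hmem e he
    rw [← Finset.sum_subset (s₁ := {e.1, e.2}) (by simp [Finset.insert_subset_iff, h1, h2])
      (fun u hu hu' => ?_), Finset.sum_pair hne]
    · have := hη.superharmonic (X e.1) (X e.2) (fun h => hne (hX h1 h2 h))
      simp only [hb, hc, hmove _ h1 _ h1, hmove _ h1 _ h2, hmove _ h2 _ h1, hmove _ h2 _ h2,
        if_true, if_neg hne, if_neg hne.symm, ← mul_sub, ← Finset.mul_sum, ← mul_add]
      exact mul_nonpos_of_nonneg_of_nonpos ha this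
    · simp only [Finset.mem_insert, Finset.mem_singleton, not_or] at hu'
      exact Finset.sum_eq_zero fun w _ => by rw [hbc u hu w e he hu'.1 hu'.2, sub_self]
  have hmain : coalGen A R (pairingWeight a η m) X
      = (∑ e ∈ m, (∏ e' ∈ m.erase e, c e') * ∑ u ∈ A, ∑ w ∈ steps d R, (b u w e - c e))
        / (steps d R).card := by
    rw [coalGen, Finset.sum_image hX]
    simp only [← Finset.sum_div]
    congr 1
    simp only [Finset.mul_sum]
    rw [Finset.sum_comm (s := m)]
    refine Finset.sum_congr rfl fun u hu => ?_
    rw [Finset.sum_comm (s := m)]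
    exact Finset.sum_congr rfl fun w _ => hprod u hu w
  rw [hmain]
  refine div_nonpos_of_nonpos_of_nonneg (Finset.sum_nonpos fun e he => ?_) (Nat.cast_nonneg _)
  exact mul_nonpos_of_nonneg_of_nonpos
    (Finset.prod_nonneg fun _ _ => mul_nonneg ha (hη.nonneg _ _)) (hedge e he)

lemma coalGen_pairingSum_nonpos [IsWellOrder (Site d) prec] (ha : 0 ≤ a)
    (hη : IsMeetingKernel R η) {A : Finset (Site d)} {X : Site d → Site d} (hX : Set.InjOn X A)
    {k : ℝ} (hk : 0 ≤ k) :
    coalGen A R (fun Y => k * pairingSum prec a η A Y) X ≤ 0 := by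
  have : coalGen A R (fun Y => k * pairingSum prec a η A Y) X
      = k * ∑ m ∈ pairings prec A, coalGen A R (pairingWeight a η m) X := by
    simp only [coalGen, pairingSum, Finset.mul_sum]
    rw [Finset.sum_comm (s := pairings prec A)]
    refine Finset.sum_congr rfl fun z _ => ?_
    rw [Finset.sum_comm (s := pairings prec A)]
    refine Finset.sum_congr rfl fun w _ => ?_
    rw [← Finset.sum_sub_distrib, Finset.sum_div]
    exact Finset.sum_congr rfl fun m _ => by ring
  rw [this]
  exact mul_nonpos_of_nonneg_of_nonpos hk
    (Finset.sum_nonpos fun m hm => coalGen_pairingWeight_nonpos ha hη hm hX)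

end VoterModel

end

noncomputable section

namespace VoterModel

/-! ### The memoryless property -/

/-- The overshoot `t - s` of an exponential time over an independent one is exponential again. -/
lemma lintegral_expMeasure_overshoot {g : ℝ → ENNReal} (hg : Measurable g) :
    ∫⁻ s, ∫⁻ t, {t : ℝ | 0 ≤ s ∧ s < t}.indicator (fun t => g (t - s)) t
      ∂(expMeasure 1) ∂(expMeasure 1) = 2⁻¹ * ∫⁻ r, g r ∂(expMeasure 1) := by
  have hm : ∀ r, Measurable (exponentialPDF r) := fun r =>
    (measurable_exponentialPDFReal r).ennreal_ofReal
  have hexp : expMeasure 1 = volume.withDensity (exponentialPDF 1) := rfl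
  have hinner : ∀ s, ∫⁻ t, {t : ℝ | 0 ≤ s ∧ s < t}.indicator (fun t => g (t - s)) t ∂(expMeasure 1)
      = (Set.Ici (0 : ℝ)).indicator (fun s => ENNReal.ofReal (Real.exp (-s))) s
        * ∫⁻ r, g r ∂(expMeasure 1) := by
    intro s
    by_cases hs : 0 ≤ s
    · have hset : MeasurableSet {t : ℝ | 0 ≤ s ∧ s < t} := by
        simp only [hs, true_and]; exact measurableSet_Ioi
      rw [hexp, lintegral_withDensity_eq_lintegral_mul _ (hm 1)
          ((by fun_prop : Measurable fun t => g (t - s)).indicator hset),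
        lintegral_withDensity_eq_lintegral_mul _ (hm 1) hg, Set.indicator_of_mem (by exact hs),
        ← lintegral_const_mul _ ((hm 1).mul hg),
        ← lintegral_add_right_eq_self _ s]
      refine lintegral_congr_ae ?_
      -- At `r = 0` the strict inequality `s < t` fails while the density is `1`, so this point must
      -- be excluded.
      filter_upwards [compl_mem_ae_iff.2 (measure_singleton (0 : ℝ))] with r hr
      have hr0 : r ≠ 0 := hr
      rcases lt_or_gt_of_ne hr0 with h | h
      · have : ¬ (s < r + s) := by linarith
        simp [Set.indicator, this, exponentialPDF_of_neg h]
      · have h1 : s < r + s := by linarith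
        have h2 : 0 ≤ r + s := by linarith
        simp only [Pi.mul_apply, Set.indicator, Set.mem_ofPred_eq, hs, h1, and_self, if_true,
          exponentialPDF_of_nonneg h2, exponentialPDF_of_nonneg h.le, add_sub_cancel_right, one_mul]
        rw [← mul_assoc, ← ENNReal.ofReal_mul (Real.exp_pos _).le, ← Real.exp_add]
        ring_nf
    · simp [hs]
  have hmE : Measurable ((Set.Ici (0 : ℝ)).indicator fun s => ENNReal.ofReal (Real.exp (-s))) :=
    (by fun_prop : Measurable fun s : ℝ => ENNReal.ofReal (Real.exp (-s))).indicator
      measurableSet_Ici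
  simp_rw [hinner]
  rw [lintegral_mul_const _ hmE]
  congr 1
  -- The tail `exp (-s)` times the density `exp (-s)` is half of the density of rate `2`.
  rw [hexp, lintegral_withDensity_eq_lintegral_mul _ (hm 1) hmE,
    ← mul_one (2⁻¹ : ENNReal), ← lintegral_exponentialPDF_eq_one (r := 2) (by norm_num),
    ← lintegral_const_mul _ (hm 2)]
  refine lintegral_congr fun s => ?_
  rcases lt_or_ge s 0 with h | h
  · simp [exponentialPDF_of_neg h]
  · have h2 : (2⁻¹ : ENNReal) = ENNReal.ofReal 2⁻¹ := by
      rw [ENNReal.ofReal_inv_of_pos (by norm_num)]; simp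
    simp only [Pi.mul_apply, exponentialPDF_of_nonneg h, Set.indicator, Set.mem_Ici, h, if_true]
    rw [h2, ← ENNReal.ofReal_mul (by positivity), ← ENNReal.ofReal_mul (by positivity)]
    congr 1
    rw [one_mul, one_mul, ← Real.exp_add]
    ring_nf

lemma ae_pos_expMeasure : ∀ᵐ s ∂(expMeasure 1), 0 < s := by
  have hexp : expMeasure 1 = volume.withDensity (exponentialPDF 1) := rfl
  rw [ae_iff, hexp]
  have : {a : ℝ | ¬ 0 < a} = Set.Iic 0 := by ext; simp
  rw [this, withDensity_apply _ measurableSet_Iic, setLIntegral_congr Iio_ae_eq_Iic.symm]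
  exact lintegral_exponentialPDF_of_nonpos le_rfl

/-! ### Sequences of steps -/

/-- Prepend a step to a sequence of steps. -/
def consSeq {α : Type*} (x : α) (ω : ℕ → α) : ℕ → α
  | 0 => x
  | k + 1 => ω k

lemma measurable_consSeq {α : Type*} [MeasurableSpace α] :
    Measurable fun p : α × (ℕ → α) => consSeq p.1 p.2 := by
  refine measurable_pi_lambda _ fun k => ?_
  cases k with
  | zero => exact measurable_fst
  | succ k => exact (measurable_pi_apply k).comp measurable_snd

lemma map_consSeq {α : Type*} [MeasurableSpace α] (ν : Measure α) [IsProbabilityMeasure ν] :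
    (ν.prod (Measure.infinitePi fun _ : ℕ => ν)).map (fun p => consSeq p.1 p.2)
      = Measure.infinitePi fun _ : ℕ => ν := by
  classical
  refine Measure.eq_infinitePi _ fun s t ht => ?_
  -- Enlarging the index set to an initial segment makes the preimage under `consSeq` a rectangle.
  obtain ⟨n, hn⟩ : ∃ n, s ⊆ Finset.range (n + 1) :=
    ⟨s.sup id, fun i hi => Finset.mem_range.2 (Nat.lt_succ_of_le (Finset.le_sup (f := id) hi))⟩
  let t' : ℕ → Set α := fun i => if i ∈ s then t i else Set.univ
  have ht' : ∀ i, MeasurableSet (t' i) := fun i => by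
    by_cases h : i ∈ s <;> simp [t', h, ht]
  have hpi : (s : Set ℕ).pi t = ((Finset.range (n + 1) : Finset ℕ) : Set ℕ).pi t' := by
    ext ω
    simp only [Set.mem_pi, Finset.mem_coe]
    refine ⟨fun h i _ => ?_, fun h i hi => ?_⟩
    · by_cases hi : i ∈ s <;> simp [t', hi, h]
    · simpa [t', hi] using h i (hn hi)
  have hprod : ∏ i ∈ s, ν (t i) = ∏ i ∈ Finset.range (n + 1), ν (t' i) := by
    rw [← Finset.prod_subset hn fun i _ hi => by simp [t', hi]]
    exact Finset.prod_congr rfl fun i hi => by simp [t', hi]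
  have hpre : (fun p : α × (ℕ → α) => consSeq p.1 p.2) ⁻¹'
      (((Finset.range (n + 1) : Finset ℕ) : Set ℕ).pi t')
      = t' 0 ×ˢ (((Finset.range n : Finset ℕ) : Set ℕ).pi fun i => t' (i + 1)) := by
    ext ⟨x, ω⟩
    simp only [Set.mem_preimage, Set.mem_pi, Finset.mem_coe, Finset.mem_range, Set.mem_prod]
    refine ⟨fun h => ⟨h 0 (by omega), fun i hi => h (i + 1) (by omega)⟩, fun h i hi => ?_⟩
    cases i with
    | zero => exact h.1
    | succ i => exact h.2 i (by omega)
  rw [hpi, Measure.map_apply measurable_consSeq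
    (MeasurableSet.pi (Set.to_countable _) fun i _ => ht' i), hpre, Measure.prod_prod,
    Measure.infinitePi_pi _ fun i _ => ht' _, hprod, Finset.prod_range_succ', mul_comm]

variable {d R : ℕ}

lemma isProbabilityMeasure_steps (hs : (steps d R).Nonempty) :
    IsProbabilityMeasure (uniformOn (ball1 d R \ {0} : Set (Site d))) := by
  rw [← coe_steps]
  exact isProbabilityMeasure_uniformOn (steps d R).finite_toSet hs

lemma lintegral_uniformOn_steps (g : Site d → ENNReal) :
    ∫⁻ w, g w ∂(uniformOn (ball1 d R \ {0} : Set (Site d)))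
      = ((steps d R).card : ENNReal)⁻¹ * ∑ w ∈ steps d R, g w := by
  rw [← coe_steps, uniformOn, ProbabilityTheory.cond, lintegral_smul_measure, Measure.count_apply_finset,
    lintegral_finset]
  simp

lemma lintegral_walkMeasure (hs : (steps d R).Nonempty) {F : (ℕ → ℝ × Site d) → ENNReal}
    (hF : Measurable F) :
    ∫⁻ ω, F ω ∂(walkMeasure d R) = ∫⁻ ω, ∫⁻ w, ∫⁻ s, F (consSeq (s, w) ω)
      ∂(expMeasure 1) ∂(uniformOn (ball1 d R \ {0})) ∂(walkMeasure d R) := by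
  have := isProbabilityMeasure_expMeasure (r := 1) one_pos
  have := isProbabilityMeasure_steps hs
  have hF' : Measurable fun p : (ℝ × Site d) × (ℕ → ℝ × Site d) => F (consSeq p.1 p.2) :=
    hF.comp measurable_consSeq
  conv_lhs => rw [walkMeasure, ← map_consSeq]
  rw [lintegral_map hF measurable_consSeq, lintegral_prod_symm _ hF'.aemeasurable]
  refine lintegral_congr fun ω => ?_
  exact lintegral_prod_symm _ (hF'.comp (measurable_id.prodMk measurable_const)).aemeasurable

/-- Shorten the first holding time by `s`. -/
def advance (s : ℝ) (ω : ℕ → ℝ × Site d) : ℕ → ℝ × Site d :=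
  consSeq ((ω 0).1 - s, (ω 0).2) fun k => ω (k + 1)

lemma measurable_advance :
    Measurable fun p : ℝ × (ℕ → ℝ × Site d) => advance p.1 p.2 := by
  refine measurable_consSeq.comp (Measurable.prodMk (by fun_prop) ?_)
  fun_prop

/-- An independent exponential time precedes the first jump with probability `1/2`, and by lack of
memory the walk seen from that time is then a fresh walk. -/
lemma lintegral_walkMeasure_advance (hs : (steps d R).Nonempty)
    {F : (ℕ → ℝ × Site d) → ENNReal} (hF : Measurable F) :
    ∫⁻ s, ∫⁻ ω, {ω : ℕ → ℝ × Site d | 0 ≤ s ∧ s < (ω 0).1}.indicator (fun ω => F (advance s ω)) ω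
      ∂(walkMeasure d R) ∂(expMeasure 1) = 2⁻¹ * ∫⁻ ω, F ω ∂(walkMeasure d R) := by
  have := isProbabilityMeasure_expMeasure (r := 1) one_pos
  have := isProbabilityMeasure_steps hs
  have : IsProbabilityMeasure (walkMeasure d R) := by unfold walkMeasure; infer_instance
  have hset : MeasurableSet {p : ℝ × (ℕ → ℝ × Site d) | 0 ≤ p.1 ∧ p.1 < (p.2 0).1} :=
    (measurableSet_le measurable_const measurable_fst).inter
      (measurableSet_lt measurable_fst (by fun_prop))
  have hK : Measurable fun p : ℝ × (ℕ → ℝ × Site d) =>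
      {p : ℝ × (ℕ → ℝ × Site d) | 0 ≤ p.1 ∧ p.1 < (p.2 0).1}.indicator
        (fun p => F (advance p.1 p.2)) p :=
    (hF.comp measurable_advance).indicator hset
  have hcons : ∀ s t : ℝ, ∀ w ω,
      {ω : ℕ → ℝ × Site d | 0 ≤ s ∧ s < (ω 0).1}.indicator (fun ω => F (advance s ω))
        (consSeq (t, w) ω)
      = {t : ℝ | 0 ≤ s ∧ s < t}.indicator (fun t => F (consSeq (t - s, w) ω)) t := fun s t w ω => rfl
  have hL : ∀ s, ∫⁻ ω, {ω : ℕ → ℝ × Site d | 0 ≤ s ∧ s < (ω 0).1}.indicator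
        (fun ω => F (advance s ω)) ω ∂(walkMeasure d R)
      = ∫⁻ ω, ∫⁻ w, ∫⁻ t, {t : ℝ | 0 ≤ s ∧ s < t}.indicator (fun t => F (consSeq (t - s, w) ω)) t
        ∂(expMeasure 1) ∂(uniformOn (ball1 d R \ {0})) ∂(walkMeasure d R) := fun s =>
    lintegral_walkMeasure hs (hK.comp (measurable_const.prodMk measurable_id))
  have hmeas : Measurable fun q : ((ℝ × (ℕ → ℝ × Site d)) × Site d) × ℝ =>
      {t : ℝ | 0 ≤ q.1.1.1 ∧ q.1.1.1 < t}.indicator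
        (fun t => F (consSeq (t - q.1.1.1, q.1.2) q.1.1.2)) q.2 := by
    have h : Measurable fun q : ((ℝ × (ℕ → ℝ × Site d)) × Site d) × ℝ =>
        (q.1.1.1, consSeq (q.2, q.1.2) q.1.1.2) := by
      refine Measurable.prodMk (by fun_prop) ?_
      exact measurable_consSeq.comp (f := fun q : ((ℝ × (ℕ → ℝ × Site d)) × Site d) × ℝ =>
        ((q.2, q.1.2), q.1.1.2)) (by fun_prop)
    exact hK.comp h
  have hmeas' := hmeas.lintegral_prod_right' (ν := expMeasure 1)
  simp_rw [hL]
  rw [lintegral_lintegral_swap (hmeas'.lintegral_prod_right' (ν := uniformOn _)).aemeasurable]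
  conv_rhs => rw [lintegral_walkMeasure hs hF]
  rw [← lintegral_const_mul']
  swap
  · simp
  refine lintegral_congr fun ω => ?_
  rw [lintegral_lintegral_swap]
  swap
  · exact (hmeas'.comp (f := fun p : ℝ × Site d => ((p.1, ω), p.2)) (by fun_prop)).aemeasurable
  rw [← lintegral_const_mul']
  swap
  · simp
  refine lintegral_congr fun w => ?_
  refine lintegral_expMeasure_overshoot (g := fun r => F (consSeq (r, w) ω)) ?_
  exact hF.comp (measurable_consSeq.comp (Measurable.prodMk (by fun_prop) measurable_const))

end VoterModel

end

noncomputable section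

namespace VoterModel

/-! ### The meeting probability is superharmonic -/

variable {d R : ℕ}

/-- The walk has made exactly `m` jumps up to time `t`. -/
def HasJumped (ω : ℕ → ℝ × Site d) (t : ℝ) (m : ℕ) : Prop :=
  t < ∑ k ∈ Finset.range (m + 1), (ω k).1 ∧ ∀ j < m, ∑ k ∈ Finset.range (j + 1), (ω k).1 ≤ t

lemma HasJumped.jumpCount_eq {ω : ℕ → ℝ × Site d} {t : ℝ} {m : ℕ} (h : HasJumped ω t m) :
    jumpCount ω t = m :=
  le_antisymm (Nat.sInf_le h.1) (le_csInf ⟨m, h.1⟩ fun j hj => by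
    by_contra hjm
    exact absurd hj (not_lt.2 (h.2 j (not_le.1 hjm))))

lemma sum_consSeq (x : ℝ × Site d) (ω : ℕ → ℝ × Site d) (m : ℕ) :
    ∑ k ∈ Finset.range (m + 1), (consSeq x ω k).1 = x.1 + ∑ k ∈ Finset.range m, (ω k).1 := by
  rw [Finset.sum_range_succ', add_comm]; rfl

lemma sum_advance (s : ℝ) (ω : ℕ → ℝ × Site d) (m : ℕ) :
    ∑ k ∈ Finset.range (m + 1), (advance s ω k).1 = ∑ k ∈ Finset.range (m + 1), (ω k).1 - s := by
  rw [advance, sum_consSeq, Finset.sum_range_succ' (fun k => (ω k).1)]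
  ring

lemma advance_snd (s : ℝ) (ω : ℕ → ℝ × Site d) (k : ℕ) : (advance s ω k).2 = (ω k).2 := by
  cases k <;> rfl

lemma HasJumped.of_tail {ω : ℕ → ℝ × Site d} {t : ℝ} {m : ℕ} (ht : 0 ≤ t)
    (h : HasJumped (fun k => ω (k + 1)) t m) : HasJumped ω (t + (ω 0).1) (m + 1) := by
  refine ⟨?_, fun j hj => ?_⟩
  · have := h.1
    rw [Finset.sum_range_succ']
    linarith
  · rw [Finset.sum_range_succ']
    cases j with
    | zero => simpa using ht
    | succ j => have := h.2 j (by omega); linarith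

lemma HasJumped.of_advance {ω : ℕ → ℝ × Site d} {s t : ℝ} {m : ℕ}
    (h : HasJumped (advance s ω) t m) : HasJumped ω (t + s) m := by
  refine ⟨?_, fun j hj => ?_⟩
  · have := h.1; rw [sum_advance] at this; linarith
  · have := h.2 j hj; rw [sum_advance] at this; linarith

/-- The walks started at `u` and `v` meet after finitely many jumps. -/
def meetSet (u v : Site d) : Set ((ℕ → ℝ × Site d) × (ℕ → ℝ × Site d)) :=
  {p | ∃ t : ℝ, 0 ≤ t ∧ ∃ m k, HasJumped p.1 t m ∧ HasJumped p.2 t k ∧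
    u + ∑ j ∈ Finset.range m, (p.1 j).2 = v + ∑ j ∈ Finset.range k, (p.2 j).2}

/-- Only this inclusion is needed, since the final bound increases with the meeting probability. On
paths whose partial sums never exceed `t`, `jumpCount` takes the default value `0`, whereas
`HasJumped` fails for every count. -/
lemma meetSet_subset (u v : Site d) :
    meetSet u v ⊆ {p | ∃ t : ℝ, 0 ≤ t ∧ walk u p.1 t = walk v p.2 t} := by
  rintro p ⟨t, ht, m, k, hm, hk, h⟩
  exact ⟨t, ht, by rw [walk, walk, hm.jumpCount_eq, hk.jumpCount_eq, h]⟩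

lemma HasJumped.exists_right {ω : ℕ → ℝ × Site d} {t : ℝ} {m : ℕ} (h : HasJumped ω t m) :
    ∃ b, t < b ∧ ∀ s, t ≤ s → s < b → HasJumped ω s m :=
  ⟨_, h.1, fun _ hs hb => ⟨hb, fun j hj => (h.2 j hj).trans hs⟩⟩

lemma measurableSet_hasJumped (t : ℝ) (m : ℕ) :
    MeasurableSet {ω : ℕ → ℝ × Site d | HasJumped ω t m} := by
  have hT : ∀ j : ℕ, Measurable fun ω : ℕ → ℝ × Site d => ∑ k ∈ Finset.range (j + 1), (ω k).1 :=
    fun j => by fun_prop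
  have hset : {ω : ℕ → ℝ × Site d | ∀ j < m, ∑ k ∈ Finset.range (j + 1), (ω k).1 ≤ t}
      = ⋂ j, ⋂ _ : j < m, {ω | ∑ k ∈ Finset.range (j + 1), (ω k).1 ≤ t} := by
    ext; simp
  have hmeas : MeasurableSet
      {ω : ℕ → ℝ × Site d | ∀ j < m, ∑ k ∈ Finset.range (j + 1), (ω k).1 ≤ t} := by
    rw [hset]
    exact MeasurableSet.iInter fun j => MeasurableSet.iInter fun _ =>
      measurableSet_le (hT j) measurable_const
  exact (measurableSet_lt measurable_const (hT m)).inter hmeas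

/-- Jump counts are constant on a short interval to the right of any time, so a meeting can be
witnessed at a rational time. The starting points are variables because `firstJumpSet` uses a random
one. -/
lemma measurableSet_meetSet_param :
    MeasurableSet {q : Site d × Site d × (ℕ → ℝ × Site d) × (ℕ → ℝ × Site d) |
      q.2.2 ∈ meetSet q.1 q.2.1} := by
  have : {q : Site d × Site d × (ℕ → ℝ × Site d) × (ℕ → ℝ × Site d) |
        q.2.2 ∈ meetSet q.1 q.2.1}
      = ⋃ r : ℚ, ⋃ m : ℕ, ⋃ k : ℕ, {q | 0 ≤ (r : ℝ) ∧ HasJumped q.2.2.1 r m ∧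
          HasJumped q.2.2.2 r k ∧ q.1 + ∑ j ∈ Finset.range m, (q.2.2.1 j).2
            = q.2.1 + ∑ j ∈ Finset.range k, (q.2.2.2 j).2} := by
    ext q
    simp only [Set.mem_iUnion]
    constructor
    · rintro ⟨t, ht, m, k, hm, hk, h⟩
      obtain ⟨b, hb, hb'⟩ := hm.exists_right
      obtain ⟨c, hc, hc'⟩ := hk.exists_right
      obtain ⟨r, hr, hr'⟩ := exists_rat_btwn (lt_min hb hc)
      exact ⟨r, m, k, ht.trans hr.le, hb' r hr.le (hr'.trans_le (min_le_left _ _)),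
        hc' r hr.le (hr'.trans_le (min_le_right _ _)), h⟩
    · rintro ⟨r, m, k, hr, hm, hk, h⟩
      exact ⟨r, hr, m, k, hm, hk, h⟩
  rw [this]
  refine MeasurableSet.iUnion fun r => MeasurableSet.iUnion fun m => MeasurableSet.iUnion fun k => ?_
  refine (MeasurableSet.const _).inter (((measurableSet_hasJumped _ _).preimage
    (by fun_prop)).inter (((measurableSet_hasJumped _ _).preimage (by fun_prop)).inter ?_))
  exact measurableSet_eq_fun (by fun_prop) (by fun_prop)

lemma measurableSet_meetSet (u v : Site d) : MeasurableSet (meetSet u v) :=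
  measurableSet_meetSet_param.preimage
    (f := fun p : (ℕ → ℝ × Site d) × (ℕ → ℝ × Site d) => (u, v, p)) (by fun_prop)

/-- The first walk jumps before the second one, and the walks meet afterwards. -/
def firstJumpSet (u v : Site d) : Set ((ℕ → ℝ × Site d) × (ℕ → ℝ × Site d)) :=
  {p | (0 ≤ (p.1 0).1 ∧ (p.1 0).1 < (p.2 0).1) ∧
    ((fun k => p.1 (k + 1)), advance (p.1 0).1 p.2) ∈ meetSet (u + (p.1 0).2) v}

lemma firstJumpSet_subset (u v : Site d) : firstJumpSet u v ⊆ meetSet u v := by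
  rintro p ⟨⟨h0, -⟩, t, ht, m, k, hm, hk, h⟩
  refine ⟨t + (p.1 0).1, by linarith, m + 1, k, hm.of_tail ht, hk.of_advance, ?_⟩
  simp only [advance_snd] at h
  rw [Finset.sum_range_succ', ← h]
  abel

lemma mem_meetSet_swap {u v : Site d} {p : (ℕ → ℝ × Site d) × (ℕ → ℝ × Site d)} :
    p.swap ∈ meetSet v u ↔ p ∈ meetSet u v := by
  constructor <;>
  · rintro ⟨t, ht, m, k, hm, hk, h⟩
    exact ⟨t, ht, k, m, hk, hm, h.symm⟩

lemma measurableSet_firstJumpSet (u v : Site d) : MeasurableSet (firstJumpSet u v) := by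
  have h1 : Measurable fun p : (ℕ → ℝ × Site d) × (ℕ → ℝ × Site d) => (p.1 0).1 := by fun_prop
  have h2 : Measurable fun p : (ℕ → ℝ × Site d) × (ℕ → ℝ × Site d) => (p.2 0).1 := by fun_prop
  have h : Measurable fun p : (ℕ → ℝ × Site d) × (ℕ → ℝ × Site d) =>
      (u + (p.1 0).2, v, (fun k => p.1 (k + 1)), advance (p.1 0).1 p.2) := by
    refine Measurable.prodMk (by fun_prop) (Measurable.prodMk (by fun_prop)
      (Measurable.prodMk (by fun_prop) ?_))
    exact measurable_advance.comp
      (f := fun p : (ℕ → ℝ × Site d) × (ℕ → ℝ × Site d) => ((p.1 0).1, p.2)) (by fun_prop)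
  exact ((measurableSet_le measurable_const h1).inter (measurableSet_lt h1 h2)).inter
    (measurableSet_meetSet_param.preimage h)

lemma isProbabilityMeasure_walkMeasure (hs : (steps d R).Nonempty) :
    IsProbabilityMeasure (walkMeasure d R) := by
  have := isProbabilityMeasure_expMeasure (r := 1) one_pos
  have := isProbabilityMeasure_steps hs
  unfold walkMeasure
  infer_instance

/-- Condition on the first step `(s, w)` of the first walk: `lintegral_walkMeasure_advance` restarts
the second walk at time `s`, and the first continues from `u + w`. -/
lemma measure_firstJumpSet (hs : (steps d R).Nonempty) (u v : Site d) :
    ((walkMeasure d R).prod (walkMeasure d R)) (firstJumpSet u v)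
      = 2⁻¹ * (((steps d R).card : ENNReal)⁻¹ * ∑ w ∈ steps d R,
        ((walkMeasure d R).prod (walkMeasure d R)) (meetSet (u + w) v)) := by
  have := isProbabilityMeasure_walkMeasure hs
  have := isProbabilityMeasure_expMeasure (r := 1) one_pos
  have := isProbabilityMeasure_steps hs
  have hind : ∀ (s : ℝ) (w : Site d) (ω : ℕ → ℝ × Site d),
      (walkMeasure d R) (Prod.mk (consSeq (s, w) ω) ⁻¹' firstJumpSet u v)
      = ∫⁻ ω', {ω' : ℕ → ℝ × Site d | 0 ≤ s ∧ s < (ω' 0).1}.indicator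
          (fun ω' => (Prod.mk ω ⁻¹' meetSet (u + w) v).indicator 1 (advance s ω')) ω'
          ∂(walkMeasure d R) := by
    intro s w ω
    rw [← lintegral_indicator_one (measurable_prodMk_left (measurableSet_firstJumpSet u v))]
    refine lintegral_congr fun ω' => ?_
    by_cases h1 : 0 ≤ s ∧ s < (ω' 0).1
    · by_cases h2 : (ω, advance s ω') ∈ meetSet (u + w) v
      · rw [Set.indicator_of_mem, Set.indicator_of_mem, Set.indicator_of_mem]
        · rfl
        · exact h2
        · exact h1
        · exact ⟨h1, h2⟩
      · rw [Set.indicator_of_notMem, Set.indicator_of_mem, Set.indicator_of_notMem]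
        · exact h2
        · exact h1
        · exact fun h => h2 h.2
    · rw [Set.indicator_of_notMem, Set.indicator_of_notMem]
      · exact h1
      · exact fun h => h1 h.1
  rw [Measure.prod_apply (measurableSet_firstJumpSet u v), lintegral_walkMeasure hs
    (measurable_measure_prodMk_left (measurableSet_firstJumpSet u v))]
  simp_rw [hind]
  have hadv : ∀ ω : ℕ → ℝ × Site d, ∀ w : Site d,
      ∫⁻ s, ∫⁻ ω', {ω' : ℕ → ℝ × Site d | 0 ≤ s ∧ s < (ω' 0).1}.indicator
          (fun ω' => (Prod.mk ω ⁻¹' meetSet (u + w) v).indicator 1 (advance s ω')) ω'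
          ∂(walkMeasure d R) ∂(expMeasure 1)
      = 2⁻¹ * (walkMeasure d R) (Prod.mk ω ⁻¹' meetSet (u + w) v) := by
    intro ω w
    have hmeas := measurable_prodMk_left (x := ω) (measurableSet_meetSet (u + w) v)
    rw [lintegral_walkMeasure_advance hs (measurable_one.indicator hmeas),
      lintegral_indicator_one hmeas]
  simp_rw [hadv, lintegral_uniformOn_steps]
  have hm : ∀ w : Site d, Measurable fun ω : ℕ → ℝ × Site d =>
      (walkMeasure d R) (Prod.mk ω ⁻¹' meetSet (u + w) v) := fun w =>
    measurable_measure_prodMk_left (measurableSet_meetSet (u + w) v)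
  rw [lintegral_const_mul _ (Finset.measurable_sum _ fun w _ => (hm w).const_mul _),
    lintegral_finsetSum _ fun w _ => (hm w).const_mul _]
  simp_rw [lintegral_const_mul _ (hm _), Measure.prod_apply (measurableSet_meetSet _ _),
    ← Finset.mul_sum]
  ring

/-- The probability that the walks started at `u` and `v` meet after finitely many jumps. -/
def meetKernel (R : ℕ) (u v : Site d) : ℝ :=
  ((walkMeasure d R).prod (walkMeasure d R)).real (meetSet u v)

lemma meetKernel_symm (hs : (steps d R).Nonempty) (u v : Site d) :
    meetKernel R u v = meetKernel R v u := by
  have := isProbabilityMeasure_walkMeasure hs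
  have h := (Measure.measurePreserving_swap (μ := walkMeasure d R)
    (ν := walkMeasure d R)).measure_preimage (measurableSet_meetSet v u).nullMeasurableSet
  have h' : Prod.swap ⁻¹' meetSet v u = meetSet u v := by
    ext p; exact mem_meetSet_swap
  rw [meetKernel, meetKernel, measureReal_def, measureReal_def, ← h, h']

lemma meetKernel_le_meetProb (hs : (steps d R).Nonempty) (u v : Site d) :
    meetKernel R u v ≤ meetProb R u v := by
  have := isProbabilityMeasure_walkMeasure hs
  exact measureReal_mono (meetSet_subset u v)

lemma measureReal_firstJumpSet (hs : (steps d R).Nonempty) (u v : Site d) :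
    ((walkMeasure d R).prod (walkMeasure d R)).real (firstJumpSet u v)
      = (∑ w ∈ steps d R, meetKernel R (u + w) v) / (2 * (steps d R).card) := by
  have := isProbabilityMeasure_walkMeasure hs
  rw [measureReal_def, measure_firstJumpSet hs, ENNReal.toReal_mul, ENNReal.toReal_mul,
    ENNReal.toReal_sum fun _ _ => measure_ne_top _ _]
  simp only [ENNReal.toReal_inv, ENNReal.toReal_ofNat, ENNReal.toReal_natCast, meetKernel,
    measureReal_def]
  rw [← mul_assoc, ← mul_inv, div_eq_inv_mul]

lemma isMeetingKernel_meetKernel (hs : (steps d R).Nonempty) :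
    IsMeetingKernel R (meetKernel (d := d) R) where
  nonneg _ _ := measureReal_nonneg
  diag u := by
    have := isProbabilityMeasure_walkMeasure hs
    have := isProbabilityMeasure_expMeasure (r := 1) one_pos
    have := isProbabilityMeasure_steps hs
    have hpos : ∀ᵐ ω ∂(walkMeasure d R), 0 < (ω 0).1 := by
      have h1 : ∀ᵐ x ∂((expMeasure 1).prod (uniformOn (ball1 d R \ {0}))), 0 < x.1 :=
        Measure.quasiMeasurePreserving_fst.ae ae_pos_expMeasure
      exact (measurePreserving_eval_infinitePi (fun _ : ℕ =>
        (expMeasure 1).prod (uniformOn (ball1 d R \ {0}))) 0).quasiMeasurePreserving.ae h1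
    have hae : ∀ᵐ p ∂((walkMeasure d R).prod (walkMeasure d R)), p ∈ meetSet u u := by
      filter_upwards [Measure.quasiMeasurePreserving_fst.ae hpos,
        Measure.quasiMeasurePreserving_snd.ae hpos] with p h1 h2
      -- Both first holding times are positive, so the walks are together at time `0` before any
      -- jump.
      exact ⟨0, le_rfl, 0, 0, ⟨by simpa using h1, by simp⟩, ⟨by simpa using h2, by simp⟩, by simp⟩
    rw [meetKernel, measureReal_def, prob_compl_eq_zero_iff (measurableSet_meetSet u u) |>.1 hae,
      ENNReal.toReal_one]
  superharmonic u v _ := by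
    have := isProbabilityMeasure_walkMeasure hs
    set Q := (walkMeasure d R).prod (walkMeasure d R) with hQ
    have hswap : Q.real (Prod.swap ⁻¹' firstJumpSet v u) = Q.real (firstJumpSet v u) := by
      rw [measureReal_def, measureReal_def, Measure.measurePreserving_swap.measure_preimage
        (measurableSet_firstJumpSet v u).nullMeasurableSet]
    have hdisj : Disjoint (firstJumpSet u v) (Prod.swap ⁻¹' firstJumpSet v u) :=
      Set.disjoint_left.2 fun p h1 h2 => lt_asymm h1.1.2 h2.1.2
    -- Either walk may jump first. These are disjoint ways to meet, so their probabilities add up to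
    -- at most the meeting probability; superharmonicity does not require equality.
    have hle : Q.real (firstJumpSet u v) + Q.real (firstJumpSet v u) ≤ meetKernel R u v := by
      rw [← hswap, ← measureReal_union hdisj
        ((measurableSet_firstJumpSet v u).preimage measurable_swap)]
      refine measureReal_mono (Set.union_subset (firstJumpSet_subset u v) fun p hp => ?_)
      exact mem_meetSet_swap.1 (firstJumpSet_subset v u hp)
    rw [hQ, measureReal_firstJumpSet hs, measureReal_firstJumpSet hs] at hle
    have hN : (0 : ℝ) < (steps d R).card := by exact_mod_cast hs.card_pos
    rw [← add_div, div_le_iff₀ (by positivity)] at hle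
    simp only [Finset.sum_sub_distrib, Finset.sum_const, nsmul_eq_mul]
    simp only [meetKernel_symm hs u (v + _)]
    linarith

end VoterModel

end

noncomputable section

namespace VoterModel

/-! ### Cylinder events under the product measure -/

variable {d : ℕ} {ι : Type*}

/-- The event that `E` occurs around each of the sites `x i`, `i ∈ J`. -/
def blockEvent (x : ι → Site d) (E : Set (Config d)) (J : Finset ι) : Set (Config d) :=
  {ξ | ∀ i ∈ J, (fun y => ξ (x i + y)) ∈ E}

/-- The sites on which `blockEvent x E J` depends if `E` depends on `B`. -/
def blockSites (x : ι → Site d) (B : Finset (Site d)) (J : Finset ι) : Finset (Site d) :=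
  J.biUnion fun i => B.image (x i + ·)

lemma mem_shiftEvent {x : Site d} {E : Set (Config d)} {ξ : Config d} :
    ξ ∈ shiftEvent x E ↔ (fun y => ξ (x + y)) ∈ E := by
  constructor
  · rintro ⟨ζ, hζ, rfl⟩
    simpa [shift] using hζ
  · intro h
    exact ⟨_, h, by funext y; simp [shift]⟩

lemma dependsOn_blockEvent {x : ι → Site d} {B : Finset (Site d)} {E : Set (Config d)}
    (hE : E ∈ cylinderSets B) (J : Finset ι) :
    DependsOn (· ∈ blockEvent x E J) (blockSites x B J : Set (Site d)) := by
  obtain ⟨E₀, rfl⟩ := hE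
  intro ξ η h
  refine propext (forall₂_congr fun i hi => ?_)
  have : B.restrict (fun y => ξ (x i + y)) = B.restrict (fun y => η (x i + y)) := by
    funext b
    refine h _ (Finset.mem_coe.2 (Finset.mem_biUnion.2 ⟨i, hi, Finset.mem_image.2 ⟨b, b.2, rfl⟩⟩))
  exact iff_of_eq (congrArg (· ∈ E₀) this)

/-- Such a set is the preimage of a subset of a finite discrete space under the continuous
restriction map. -/
lemma isClopen_of_dependsOn {A : Finset (Site d)} {s : Set (Config d)}
    (hs : DependsOn (· ∈ s) (A : Set (Site d))) : IsClopen s := by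
  have h : s = A.restrict ⁻¹' (A.restrict '' s) := by
    refine (Set.subset_preimage_image _ _).antisymm fun ξ hξ => ?_
    obtain ⟨η, hη, hr⟩ := hξ
    exact (hs fun i hi => congrFun hr ⟨i, hi⟩).mp hη
  rw [h]
  exact (isClopen_discrete _).preimage (by fun_prop)

/-- The indicator function of a clopen event as a continuous function. -/
def clopenIndicator {s : Set (Config d)} (hs : IsClopen s) : C(Config d, ℝ) :=
  ⟨s.indicator 1, hs.continuous_indicator continuous_one⟩

lemma integral_clopenIndicator_comp {s : Set (Config d)} (hs : IsClopen s) (X : Site d → Site d)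
    (π : Measure (Config d)) : ∫ ξ, clopenIndicator hs (ξ ∘ X) ∂π = π.real {ξ | ξ ∘ X ∈ s} := by
  have hm : MeasurableSet {ξ : Config d | ξ ∘ X ∈ s} :=
    (hs.preimage (by fun_prop : Continuous fun ξ : Config d => ξ ∘ X)).isOpen.measurableSet
  rw [← integral_indicator_one hm]
  rfl

variable (α : I)

instance : IsProbabilityMeasure (productBernoulli d α) := by
  unfold productBernoulli; infer_instance

lemma map_productBernoulli_comp {κ : Type*} {j : κ → Site d} (hj : Function.Injective j) :
    (productBernoulli d α).map (fun ξ q => ξ (j q))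
      = Measure.infinitePi fun _ : κ => bernoulliMeasure true false α := by
  have hindep : iIndepFun (fun (y : Site d) (ξ : Config d) => ξ y) (productBernoulli d α) :=
    iIndepFun_infinitePi (X := fun _ b => b) fun _ => measurable_id
  rw [(hindep.precomp hj).map_fun_eq_infinitePi_map fun q => measurable_pi_apply _]
  congr 1
  funext q
  exact (measurePreserving_eval_infinitePi
    (fun _ : Site d => bernoulliMeasure true false α) (j q)).map_eq

/-- Under the product measure, distinct positions of the walkers make the blocks independent. -/
lemma productBernoulli_blockEvent {x : ι → Site d} {B : Finset (Site d)}
    (hx : Pairwise fun i j => Disjoint (B.image (x i + ·)) (B.image (x j + ·)))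
    {E : Set (Config d)} (hE : E ∈ cylinderSets B) (J : Finset ι) {X : Site d → Site d}
    (hX : Set.InjOn X (blockSites x B J)) :
    (productBernoulli d α).real {ξ | ξ ∘ X ∈ blockEvent x E J}
      = (productBernoulli d α).real E ^ J.card := by
  obtain ⟨E₀, rfl⟩ := hE
  have hmeas : MeasurableSet E₀ := E₀.toFinite.measurableSet
  have hmem : ∀ q : J × B, x q.1 + q.2 ∈ (blockSites x B J : Set (Site d)) := fun q =>
    Finset.mem_coe.2 (Finset.mem_biUnion.2 ⟨q.1, q.1.2, Finset.mem_image.2 ⟨q.2, q.2.2, rfl⟩⟩)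
  have hj : Function.Injective fun q : J × B => X (x q.1 + q.2) := by
    rintro ⟨i, b⟩ ⟨i', b'⟩ h
    have h' : x i + (b : Site d) = x i' + b' := hX (hmem (i, b)) (hmem (i', b')) h
    have hii : i = i' := by
      by_contra hne
      refine Finset.disjoint_left.1 (hx fun h => hne (Subtype.ext h))
        (Finset.mem_image.2 ⟨b, b.2, rfl⟩) ?_
      exact Finset.mem_image.2 ⟨b', b'.2, h'.symm⟩
    subst hii
    simpa using h'
  have hmap := map_productBernoulli_comp (d := d) α hj
  -- Grouping the independent coordinates indexed by `J × B` by their first index gives independent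
  -- blocks.
  have hcurry := congrArg (Measure.map (MeasurableEquiv.curry J B Bool)) hmap
  rw [Measure.infinitePi_map_curry (fun _ _ => bernoulliMeasure true false α),
    Measure.map_map (MeasurableEquiv.measurable _) (by fun_prop)] at hcurry
  have hblock : (productBernoulli d α) {ξ | ξ ∘ X ∈ blockEvent x {ξ | B.restrict ξ ∈ E₀} J}
      = (Measure.infinitePi fun _ : B => bernoulliMeasure true false α) E₀ ^ J.card := by
    have h1 := congrArg (fun ν => ν (((Finset.univ : Finset J) : Set J).pi fun _ => E₀)) hcurry
    rw [Measure.infinitePi_pi _ fun _ _ => hmeas, Measure.map_apply (by fun_prop)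
      (MeasurableSet.pi (Set.to_countable _) fun _ _ => hmeas)] at h1
    simp only [Finset.prod_const, Finset.card_univ, Fintype.card_coe] at h1
    rw [← h1]
    congr 1
    ext ξ
    simp only [Set.mem_preimage, Set.mem_pi, Finset.coe_univ, Set.mem_univ, true_imp_iff,
      Subtype.forall]
    rfl
  have hone : (productBernoulli d α) {ξ | B.restrict ξ ∈ E₀}
      = (Measure.infinitePi fun _ : B => bernoulliMeasure true false α) E₀ := by
    rw [← map_productBernoulli_comp (d := d) α (j := fun b : B => (b : Site d))
      Subtype.val_injective, Measure.map_apply (by fun_prop) hmeas]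
    rfl
  rw [measureReal_def, measureReal_def, hblock, hone, ENNReal.toReal_pow]

/-- A null cylinder event stays null if it is read at other positions. -/
lemma productBernoulli_blockEvent_eq_zero {x : ι → Site d} {B : Finset (Site d)}
    {E : Set (Config d)} (hE : E ∈ cylinderSets B) (h0 : (productBernoulli d α).real E = 0)
    {J : Finset ι} (hJ : J.Nonempty) (X : Site d → Site d) :
    (productBernoulli d α).real {ξ | ξ ∘ X ∈ blockEvent x E J} = 0 := by
  obtain ⟨E₀, rfl⟩ := hE
  obtain ⟨i, hi⟩ := hJ
  have h0' : (productBernoulli d α) {ξ | B.restrict ξ ∈ E₀} = 0 :=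
    (measureReal_eq_zero_iff).1 h0
  -- A null cylinder event contains only configurations with an impossible state at some site of
  -- `B`. Almost surely no site has an impossible state, so rereading at arbitrary, possibly
  -- coinciding, positions keeps the event null.
  have hval : ∀ ξ : Config d, B.restrict ξ ∈ E₀ →
      ∃ b ∈ B, bernoulliMeasure true false α {ξ b} = 0 := by
    intro ξ hξ
    have h1 : (productBernoulli d α) ((B : Set (Site d)).pi fun b => {ξ b}) = 0 := by
      refine measure_mono_null (fun η hη => ?_) h0'
      have : B.restrict η = B.restrict ξ := by
        funext b
        exact hη b b.2
      exact Set.mem_ofPred.2 (this ▸ hξ)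
    rw [productBernoulli, Measure.infinitePi_pi _ fun _ _ => measurableSet_singleton _] at h1
    exact Finset.prod_eq_zero_iff.1 h1
  have hae : ∀ᵐ ξ ∂(productBernoulli d α), ∀ y : Site d,
      bernoulliMeasure true false α {ξ y} ≠ 0 := by
    refine ae_all_iff.2 fun y => ?_
    have h2 : ∀ᵐ b ∂(bernoulliMeasure true false α), bernoulliMeasure true false α {b} ≠ 0 := by
      rw [ae_iff]
      have : {b : Bool | ¬ bernoulliMeasure true false α {b} ≠ 0}
          = ⋃ b ∈ {b : Bool | bernoulliMeasure true false α {b} = 0}, {b} := by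
        ext; simp
      rw [this]
      exact (measure_biUnion_null_iff (Set.to_countable _)).2 fun b hb => hb
    exact (measurePreserving_eval_infinitePi
      (fun _ : Site d => bernoulliMeasure true false α) y).quasiMeasurePreserving.ae h2
  rw [measureReal_def, ENNReal.toReal_eq_zero_iff]
  left
  refine measure_mono_null (fun ξ hξ => ?_) (ae_iff.1 hae)
  obtain ⟨b, -, hb⟩ := hval _ (hξ i hi)
  exact fun h => h _ hb

/-! ### The correlation inequality -/

variable {α} {R : ℕ} {S : ℝ≥0 → C(Config d, ℝ) →ₗ[ℝ] C(Config d, ℝ)}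
  {prec : Site d → Site d → Prop} {η : Site d → Site d → ℝ}

lemma isClopen_blockEvent {x : ι → Site d} {B : Finset (Site d)} {E : Set (Config d)}
    (hE : E ∈ cylinderSets B) (J : Finset ι) : IsClopen (blockEvent x E J) :=
  isClopen_of_dependsOn (dependsOn_blockEvent hE J)

lemma dependsOn_clopenIndicator {A : Finset (Site d)} {s : Set (Config d)}
    (hs : DependsOn (· ∈ s) (A : Set (Site d))) (hs' : IsClopen s) :
    DependsOn (clopenIndicator hs') (A : Set (Site d)) := by
  intro ξ ζ h
  have h' : (ξ ∈ s) = (ζ ∈ s) := hs h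
  by_cases hξ : ξ ∈ s
  · have hζ : ζ ∈ s := h' ▸ hξ
    simp [clopenIndicator, hξ, hζ]
  · have hζ : ζ ∉ s := h' ▸ hξ
    simp [clopenIndicator, hξ, hζ]

lemma blockSites_mono (x : ι → Site d) (B : Finset (Site d)) {J J' : Finset ι} (h : J' ⊆ J) :
    blockSites x B J' ⊆ blockSites x B J :=
  Finset.biUnion_subset_biUnion_of_subset_left _ h

/-- When two walkers meet, their blocks are given up; otherwise the matching sum is superharmonic
and dominates the block probability at time `0`. -/
lemma meanAt_blockEvent_le [IsWellOrder (Site d) prec] (hS : IsVoterSemigroup d R S)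
    (hs : (steps d R).Nonempty) (hη : IsMeetingKernel R η) {x : ι → Site d}
    {B : Finset (Site d)}
    (hx : Pairwise fun i j => Disjoint (B.image (x i + ·)) (B.image (x j + ·)))
    {E : Set (Config d)} (hE : E ∈ cylinderSets B) (hp : 0 < (productBernoulli d α).real E)
    (J : Finset ι) :
    ∀ (X : Site d → Site d) (t : ℝ), 0 ≤ t →
      meanAt (productBernoulli d α) S
        ((clopenIndicator (isClopen_blockEvent (x := x) hE J)).comp (relabel X)) t
      ≤ (productBernoulli d α).real E ^ J.card *
        pairingSum prec (((productBernoulli d α).real E ^ 2)⁻¹ - 1) η (blockSites x B J) X := by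
  classical
  set p := (productBernoulli d α).real E with hpdef
  have hp1 : p ≤ 1 := measureReal_le_one
  set a := (p ^ 2)⁻¹ - 1 with hadef
  have ha : 0 ≤ a := sub_nonneg.2 ((one_le_inv₀ (by positivity)).2 (pow_le_one₀ hp.le hp1))
  induction J using Finset.strongInduction with
  | H J ih =>
  intro X₀ t₀ ht₀
  refine meanAt_relabel_le (productBernoulli d α) hS hs
    (dependsOn_clopenIndicator (dependsOn_blockEvent hE J) (isClopen_blockEvent hE J))
    (W := fun X => p ^ J.card * pairingSum prec a η (blockSites x B J) X) (c := 0)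
    (fun X => mul_nonneg (by positivity) (zero_le_one.trans (one_le_pairingSum ha hη _ X)))
    (fun X => ?_) X₀ ht₀
  by_cases hX : Set.InjOn X (blockSites x B J)
  · right
    refine ⟨coalGen_pairingSum_nonpos ha hη hX (by positivity), ?_⟩
    rw [integral_clopenIndicator_comp, productBernoulli_blockEvent α hx hE J hX]
    exact le_mul_of_one_le_right (by positivity) (one_le_pairingSum ha hη _ X)
  · left
    intro t ht
    simp only [Set.InjOn, not_forall] at hX
    obtain ⟨u, hu, v, hv, huv, hne⟩ := hX
    obtain ⟨i, hi, hui⟩ := Finset.mem_biUnion.1 (Finset.mem_coe.1 hu)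
    obtain ⟨j, hj, hvj⟩ := Finset.mem_biUnion.1 (Finset.mem_coe.1 hv)
    -- The colliding walkers belong to the blocks `i` and `j`, which may coincide; one or two blocks
    -- are dropped.
    set J' := (J.erase i).erase j with hJ'
    have hsub : J' ⊆ J := (Finset.erase_subset _ _).trans (Finset.erase_subset _ _)
    have hss : J' ⊂ J := Finset.ssubset_iff_subset_ne.2
      ⟨hsub, fun h => by rw [← h] at hi; simp [J'] at hi⟩
    have hnot : ∀ (k : ι) (z : Site d), z ∈ B.image (x k + ·) → k ∉ J' →
        z ∉ blockSites x B J' := by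
      intro k z hz hk hz'
      obtain ⟨l, hl, hzl⟩ := Finset.mem_biUnion.1 hz'
      exact Finset.disjoint_left.1 (hx fun h : k = l => hk (h ▸ hl)) hz hzl
    have hcollapse := one_add_mul_pairingSum_le (prec := prec) ha hη (blockSites_mono x B hsub)
      hu hv hne (hnot i u hui (by simp [J'])) (hnot j v hvj (by simp [J'])) huv
    have hcard : J.card ≤ J'.card + 2 := by
      have h1 := Finset.pred_card_le_card_erase (s := J) (a := i)
      have h2 := Finset.pred_card_le_card_erase (s := J.erase i) (a := j)
      rw [hJ']
      omega
    have hmono : (clopenIndicator (isClopen_blockEvent (x := x) hE J)).comp (relabel X)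
        ≤ (clopenIndicator (isClopen_blockEvent (x := x) hE J')).comp (relabel X) := fun ξ =>
      Set.indicator_le_indicator_of_subset (s := blockEvent x E J) (t := blockEvent x E J')
        (fun ζ hζ k hk => hζ k (hsub hk)) (fun _ => zero_le_one) _
    calc _ ≤ _ := meanAt_mono _ hS.markov hmono t
      _ ≤ p ^ J'.card * pairingSum prec a η (blockSites x B J') X := ih J' hss X t ht
      -- Here `1 + a = (p ^ 2)⁻¹` pays for the two extra powers of `p`.
      _ = p ^ (J'.card + 2) * ((1 + a) * pairingSum prec a η (blockSites x B J') X) := by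
        rw [hadef, pow_add]
        field_simp
        ring
      _ ≤ p ^ J.card * pairingSum prec a η (blockSites x B J) X := by
        refine mul_le_mul (pow_le_pow_of_le_one hp.le hp1 hcard) hcollapse ?_ (by positivity)
        exact mul_nonneg (by linarith)
          (zero_le_one.trans (one_le_pairingSum ha hη _ X))

lemma meanAt_blockEvent_le_zero (hS : IsVoterSemigroup d R S) (hs : (steps d R).Nonempty)
    {x : ι → Site d} {B : Finset (Site d)} {E : Set (Config d)} (hE : E ∈ cylinderSets B)
    (hp : (productBernoulli d α).real E = 0) {J : Finset ι} (hJ : J.Nonempty)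
    (X : Site d → Site d) {t : ℝ} (ht : 0 ≤ t) :
    meanAt (productBernoulli d α) S
      ((clopenIndicator (isClopen_blockEvent (x := x) hE J)).comp (relabel X)) t ≤ 0 :=
  meanAt_relabel_le (productBernoulli d α) hS hs
    (dependsOn_clopenIndicator (dependsOn_blockEvent hE J) (isClopen_blockEvent hE J))
    (W := fun _ => 0) (c := 0) (fun _ => le_rfl)
    -- The constant `0` is harmonic, and the block event is null at time `0` for every choice of
    -- positions, so no induction on collisions is needed.
    (fun Y => Or.inr ⟨by simp [coalGen], by
      rw [integral_clopenIndicator_comp, productBernoulli_blockEvent_eq_zero α hE hp hJ]⟩) X ht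

/-- A bound on the means at all times is inherited by the limit law. -/
lemma measureReal_le_of_meanAt_le {μ : Measure (Config d)} {s : Set (Config d)} (hs : IsClopen s)
    {c : ℝ} (hμ : Tendsto (fun t : ℝ≥0 => ∫ ξ, S t (clopenIndicator hs) ξ ∂(productBernoulli d α))
      atTop (𝓝 (∫ ξ, clopenIndicator hs ξ ∂μ)))
    (h : ∀ t : ℝ, 0 ≤ t →
      meanAt (productBernoulli d α) S ((clopenIndicator hs).comp (relabel id)) t ≤ c) :
    μ.real s ≤ c := by
  have h1 : μ.real s = ∫ ξ, clopenIndicator hs ξ ∂μ :=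
    (integral_clopenIndicator_comp hs id μ).symm
  rw [h1]
  refine le_of_tendsto' hμ fun t => ?_
  have h2 := h t t.2
  rwa [meanAt, Real.toNNReal_coe] at h2

end VoterModel

end

open VoterModel Classical in
theorem lemma2p2 (d : ℕ) (hd : 3 ≤ d) (R : ℕ) (hR : 1 ≤ R) (α : unitInterval)
    (μ : MeasureTheory.Measure (Config d)) (hμ : IsVoterLimit d R α μ)
    (prec : Site d → Site d → Prop) [IsWellOrder (Site d) prec]
    (B : Finset (Site d)) (hB : 0 ∈ B) (n : ℕ) (x : Fin n → Site d)
    (hx : Pairwise fun i j => Disjoint (B.image (x i + ·)) (B.image (x j + ·)))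
    (E : Set (Config d)) (hE : E ∈ cylinderSets B) :
    μ.real (⋂ i, shiftEvent (x i) E) ≤
      (productBernoulli d α).real E ^ n *
        ∏ p ∈ ((Finset.univ.biUnion fun i => B.image (x i + ·)) ×ˢ
            (Finset.univ.biUnion fun i => B.image (x i + ·))).filter
              (fun p : Site d × Site d => prec p.1 p.2),
          (1 + meetProb R p.1 p.2 * (((productBernoulli d α).real E ^ 2)⁻¹ - 1)) := by
  obtain ⟨hprob, S, hS, hlim⟩ := hμ
  have hs : (steps d R).Nonempty := steps_nonempty (by omega) hR
  have hset : (⋂ i, shiftEvent (x i) E) = blockEvent x E Finset.univ := by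
    ext ξ
    simp [blockEvent, mem_shiftEvent]
  rw [hset]
  rcases (MeasureTheory.measureReal_nonneg (μ := productBernoulli d α) (s := E)).eq_or_lt
    with hp | hp
  -- If `p = 0`, the inverse in the product takes the default value `0`. For `n = 0` the product is
  -- empty, and for `n ≥ 1` the prefactor `0 ^ n` annihilates it.
  · rcases Nat.eq_zero_or_pos n with rfl | hn
    · simp
    · have hne : (Finset.univ : Finset (Fin n)).Nonempty := ⟨⟨0, hn⟩, Finset.mem_univ _⟩
      have h0 := measureReal_le_of_meanAt_le (isClopen_blockEvent (x := x) hE Finset.univ)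
        (hlim _) fun t ht => meanAt_blockEvent_le_zero hS hs hE hp.symm hne id ht
      rw [← hp, zero_pow hn.ne', zero_mul]
      exact h0
  · have hη := isMeetingKernel_meetKernel (d := d) hs
    have hle := measureReal_le_of_meanAt_le (isClopen_blockEvent (x := x) hE Finset.univ)
      (hlim _) fun t ht => meanAt_blockEvent_le (prec := prec) hS hs hη hx hE hp Finset.univ id t ht
    have ha : 0 ≤ ((productBernoulli d α).real E ^ 2)⁻¹ - 1 :=
      sub_nonneg.2 ((one_le_inv₀ (by positivity)).2
        (pow_le_one₀ hp.le MeasureTheory.measureReal_le_one))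
    refine hle.trans ?_
    rw [Finset.card_univ, Fintype.card_fin]
    -- The walkers start at their own labels, `X = id`, so the edge weights become meeting
    -- probabilities of the sites themselves.
    refine mul_le_mul_of_nonneg_left ((pairingSum_le_prod ha hη _ _).trans ?_) (by positivity)
    refine Finset.prod_le_prod (fun e _ => ?_) fun e _ => ?_
    · have := mul_nonneg ha (hη.nonneg (id e.1) (id e.2))
      linarith
    · rw [mul_comm]
      gcongr
      exact meetKernel_le_meetProb hs _ _
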